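/- Let $t,r\ge 1$ be integers, $N=t+r$ (so that $m=t+r=N$), and $K\ge N$. Let $M\in\mathbb C^{N\times N}$ be Hermitian positive definite, and let $n,n_1,\dots,n_K$ be independent identically distributed $N$-dimensional circular complex normal vectors with zero mean and covariance matrix $M$, i.e. with density $\pi^{-N}\det(M)^{-1}e^{-v^\dagger M^{-1}v}$ with respect to Lebesgue measure on $\mathbb C^N$. Let $\theta_{10},\theta_{11}\in\mathbb C^{t}$ and $\theta_2\in\mathbb C^{r}$ be deterministic, and let $E_t=[I_t\ 0]^T\in\mathbb C^{N\times t}$, $E_r=[0\ I_r]^T\in\mathbb C^{N\times r}$. Under the hypothesis $H_i$, $i\in\{0,1\}$, the observed data are $$z=E_t\theta_{1i}+i\,E_r\theta_2+n,\qquad z_k=n_k,\quad k=1,\dots,K.$$ Put $S=\sum_{k=1}^K z_kz_k^\dagger$, let $z_2\in\mathbb C^r$ be the vector of the last $r$ entries of $z$, and let $S_{22}$ and $M_{22}$ be the lower right $r\times r$ blocks of $S$ and $M$. Let $\mathrm{SINR}=\theta_2^\dagger M_{22}^{-1}\theta_2$. Then, under $H_i$, $i=0,1$, the matrix $S_{22}$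 is almost surely positive definite, and the random variable $p_3=1/(1+z_2^\dagger S_{22}^{-1}z_2)$ has the probability density function (with respect to Lebesgue measure) $$f_{p_3}(x;H_i)=f_\beta(x;K-r+1,r)\,e^{-i\,\mathrm{SINR}\,x}\sum_{k=0}^{K-r+1}\binom{K-r+1}{k}\frac{(r-1)!}{(r+k-1)!}\bigl[i\,\mathrm{SINR}\,(1-x)\bigr]^k,\qquad x\in(0,1],$$ and $f_{p_3}(x;H_i)=0$ for $x\notin(0,1]$. Here $0^0=1$, and $$f_\beta(x;n,m)=\frac{(n+m-1)!}{(n-1)!\,(m-1)!}\,x^{n-1}(1-x)^{m-1}$$ is the density on $(0,1]$ of the complex central beta distribution with $n,m$ complex degrees of freedom. -/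

import Mathlib

open MeasureTheory ProbabilityTheory Matrix
open scoped Nat ENNReal ComplexOrder

namespace SubspaceDetection

noncomputable section

/-- The Hermitian form `vᴴ A v`, read as a real number (it is real when `A` is Hermitian). -/
def quadForm {ι : Type*} [Fintype ι] (A : Matrix ι ι ℂ) (v : ι → ℂ) : ℝ :=
  (star v ⬝ᵥ (A *ᵥ v)).re

/-- The (circular) complex normal distribution `CN(m, M)` with mean `m` and positive definite
covariance matrix `M`: the measure with density
`π ^ (-n) * det(M)⁻¹ * exp (-(x - m)ᴴ M⁻¹ (x - m))` with respect to Lebesgue measure on `ℂ ^ n`. -/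
def complexNormal {ι : Type*} [Fintype ι] [DecidableEq ι] (m : ι → ℂ) (M : Matrix ι ι ℂ) :
    Measure (ι → ℂ) :=
  volume.withDensity fun x =>
    ENNReal.ofReal (Real.exp (-quadForm M⁻¹ (x - m)) / (Real.pi ^ Fintype.card ι * M.det.re))

/-- `E_t = [I_t 0]ᵀ`, for `N = t + r`; rows are indexed by the partition `Fin t ⊕ Fin r`. -/
def Et (t r : ℕ) : Matrix (Fin t ⊕ Fin r) (Fin t) ℂ := Matrix.fromRows 1 0

/-- `E_r = [0 I_r]ᵀ`, for `N = t + r`. -/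
def Er (t r : ℕ) : Matrix (Fin t ⊕ Fin r) (Fin r) ℂ := Matrix.fromRows 0 1

/-- Primary data in canonical form under `H_i`, `i = 0, 1`:
`z = E_t θ₁ + n` under `H_0` and `z = E_t θ₁ + E_r θ₂ + n` under `H_1`. -/
def primaryData {t r : ℕ} (i : Fin 2) (θ₁ : Fin t → ℂ) (θ₂ : Fin r → ℂ)
    (n : Fin t ⊕ Fin r → ℂ) : Fin t ⊕ Fin r → ℂ :=
  Et t r *ᵥ θ₁ + ((i : ℕ) : ℂ) • (Er t r *ᵥ θ₂) + n

/-- `S = Z_s Z_sᴴ`, where the columns of `Z_s = [z_1 ... z_K]` are the secondary data. -/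
def scatterMatrix {ι : Type*} {K : ℕ} (zs : Fin K → ι → ℂ) : Matrix ι ι ℂ :=
  let Zs : Matrix ι (Fin K) ℂ := Matrix.of fun a k => zs k a
  Zs * Zsᴴ

/-- `p₃ = 1 / (1 + z₂ᴴ S₂₂⁻¹ z₂)`. -/
def p₃ {t r : ℕ} (z : Fin t ⊕ Fin r → ℂ) (S : Matrix (Fin t ⊕ Fin r) (Fin t ⊕ Fin r) ℂ) : ℝ :=
  1 / (1 + quadForm S.toBlocks₂₂⁻¹ (fun a => z (Sum.inr a)))

/-- `SINR = θ₂ᴴ M₂₂⁻¹ θ₂`. -/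
def SINR {t r : ℕ} (θ₂ : Fin r → ℂ) (M : Matrix (Fin t ⊕ Fin r) (Fin t ⊕ Fin r) ℂ) : ℝ :=
  quadForm M.toBlocks₂₂⁻¹ θ₂

/-- Formula on `(0, 1]` of the density of the complex central beta distribution with `n, m ≥ 1`
complex degrees of freedom. -/
def complexBetaPDF (n m : ℕ) (x : ℝ) : ℝ :=
  ((n + m - 1)! : ℝ) / (((n - 1)! : ℝ) * ((m - 1)! : ℝ)) * x ^ (n - 1) * (1 - x) ^ (m - 1)

end

end SubspaceDetection

open SubspaceDetection

/-!
The form `z₂ᴴ S₂₂⁻¹ z₂` does not change when the second block of all data is multiplied by an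
invertible matrix. A block upper triangular matrix `C` with `C M Cᴴ = 1` and lower right block `D`
(`exists_block_whitening`) therefore reduces the claim to independent standard complex normal
vectors of dimension `r`: with `u = D z₂ ~ CN(μ, 1)` and `S` the scatter matrix of the images under
`D` of the second blocks of the `n_k`, one has `p₃ = 1 / (1 + uᴴ S⁻¹ u)`, where
`‖μ‖² = i SINR =: δ` because `i ∈ {0, 1}`.

For fixed `v ≠ 0`, a unitary rotation moves `v` to `‖v‖ e₀`, and `(S⁻¹)₀₀` is the inverse of the
squared distance from the first row of the data matrix to the span of the other `r - 1` rows
(`quadForm_inv_single_zero`). This squared distance is `aᴴ Q a`, for `a` standard complex normal in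
`ℂ ^ K` and `Q` a projection of rank `d = K - r + 1`. Its Laplace transform is
`det (1 - t Q)⁻¹ = (1 - t) ^ (-d)`, so that it has the gamma law of shape `d`
(`map_quadForm_rowCoproj`). In particular it is almost surely nonzero, which by induction on the
number of rows makes Gram matrices almost surely positive definite (`ae_posDef_mul_conjTranspose`).

Hence, given `u`, the variable `p₃` is distributed as `g / (g + ‖u‖²)` with `g` of gamma law, and
has density `x ^ (d - 1) (1 - x) ^ (-d - 1) / (d - 1)! * ‖u‖ ^ (2 d) exp (-‖u‖² x / (1 - x))` on
`(0, 1)` (`lintegral_gammaMeasure_ratio`). Averaging over `u` requires the `d`-th derivative, at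
`t = -x / (1 - x)`, of the moment generating function `(1 - t) ^ (-r) exp (δ t / (1 - t))` of
`‖u‖²`. An induction on the order of the derivative (`hasDerivAt_chiSqMGFDeriv`) gives it as
`(1 - t) ^ (-r - d) exp (δ t / (1 - t))` times a polynomial in `δ / (1 - t) = δ (1 - x)`, which is
the sum in the density.
-/

namespace SubspaceDetection

/-! ### Standard complex normal vectors -/

lemma quadForm_one {ι : Type*} [Fintype ι] [DecidableEq ι] (v : ι → ℂ) :
    quadForm 1 v = ∑ i, ‖v i‖ ^ 2 := by
  simp only [quadForm, one_mulVec, dotProduct, Pi.star_apply, Complex.re_sum]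
  refine Finset.sum_congr rfl fun i _ => ?_
  rw [Complex.star_def, ← Complex.normSq_eq_conj_mul_self, Complex.ofReal_re,
    Complex.normSq_eq_norm_sq]

lemma quadForm_conj {ι κ : Type*} [Fintype ι] [Fintype κ] (A : Matrix κ κ ℂ)
    (C : Matrix κ ι ℂ) (v : ι → ℂ) :
    quadForm A (C *ᵥ v) = quadForm (Cᴴ * A * C) v := by
  simp only [quadForm, star_mulVec, dotProduct_mulVec, vecMul_vecMul, Matrix.mul_assoc]

lemma continuous_quadForm {ι : Type*} [Fintype ι] (A : Matrix ι ι ℂ) :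
    Continuous (quadForm A) := by
  unfold quadForm
  fun_prop

lemma integral_exp_neg_mul_quadForm_one {ι : Type*} [Fintype ι] [DecidableEq ι] {b : ℝ}
    (hb : 0 < b) :
    ∫ x : ι → ℂ, Real.exp (-b * quadForm 1 x) = (Real.pi / b) ^ Fintype.card ι := by
  have h1 : ∫ z : ℂ, Real.exp (-b * ‖z‖ ^ 2) = Real.pi / b := by
    rw [GaussianFourier.integral_rexp_neg_mul_sq_norm hb]
    simp [Complex.finrank_real_complex]
  rw [← h1, ← integral_fintype_prod_volume_eq_pow]
  simp only [quadForm_one, Finset.mul_sum, Real.exp_sum]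

lemma lintegral_exp_neg_mul_quadForm_one {ι : Type*} [Fintype ι] [DecidableEq ι] {b : ℝ}
    (hb : 0 < b) :
    ∫⁻ x : ι → ℂ, ENNReal.ofReal (Real.exp (-b * quadForm 1 x))
      = ENNReal.ofReal ((Real.pi / b) ^ Fintype.card ι) := by
  have h := integral_exp_neg_mul_quadForm_one (ι := ι) hb
  rw [← h, ofReal_integral_eq_lintegral_ofReal]
  · by_contra hn
    rw [integral_undef hn] at h
    have : 0 < (Real.pi / b) ^ Fintype.card ι := by positivity
    exact this.ne h
  · exact ae_of_all _ fun x => (Real.exp_pos _).le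

lemma det_re_pos {ι : Type*} [Fintype ι] [DecidableEq ι] {M : Matrix ι ι ℂ} (hM : M.PosDef) :
    0 < M.det.re := (Complex.pos_iff.mp hM.det_pos).1

open scoped MatrixOrder in
/-- Every positive definite matrix is brought to the identity by a congruence. -/
lemma exists_whitening {ι : Type*} [Fintype ι] [DecidableEq ι] {M : Matrix ι ι ℂ}
    (hM : M.PosDef) : ∃ C : Matrix ι ι ℂ, IsUnit C ∧ C * M * Cᴴ = 1 := by
  obtain ⟨y, hy, rfl⟩ := CStarAlgebra.isStrictlyPositive_iff_eq_star_mul_self.mp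
    hM.isStrictlyPositive
  lift y to (Matrix ι ι ℂ)ˣ using hy
  refine ⟨star (↑y⁻¹ : Matrix ι ι ℂ), (Units.isUnit y⁻¹).star, ?_⟩
  rw [← star_eq_conjTranspose, star_star, ← Matrix.mul_assoc, ← star_mul, Units.mul_inv,
    star_one, Matrix.one_mul, Units.mul_inv]

/-- The real determinant of a complex linear map is the squared modulus of its complex
determinant. -/
lemma volume_map_mulVec {ι : Type*} [Fintype ι] [DecidableEq ι] {C : Matrix ι ι ℂ}
    (hC : IsUnit C) :
    (volume : Measure (ι → ℂ)).map (C *ᵥ ·) = ENNReal.ofReal (Complex.normSq C.det)⁻¹ • volume := by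
  have hd : C.det ≠ 0 := ((Matrix.isUnit_iff_isUnit_det C).mp hC).ne_zero
  have hdet : LinearMap.det ((Matrix.toLin' C).restrictScalars ℝ) = Complex.normSq C.det := by
    rw [LinearMap.det_restrictScalars, LinearMap.det_toLin', Algebra.norm_complex_apply]
  have h := Measure.map_linearMap_addHaar_eq_smul_addHaar (volume : Measure (ι → ℂ))
    (f := (Matrix.toLin' C).restrictScalars ℝ) (by rw [hdet]; simpa using hd)
  rw [hdet, abs_of_nonneg (inv_nonneg.mpr (Complex.normSq_nonneg _))] at h
  rw [← h]
  rfl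

lemma lintegral_comp_mulVec {ι : Type*} [Fintype ι] [DecidableEq ι] {C : Matrix ι ι ℂ}
    (hC : IsUnit C) {f : (ι → ℂ) → ℝ≥0∞} (hf : Measurable f) :
    ∫⁻ x, f (C *ᵥ x) = ENNReal.ofReal (Complex.normSq C.det)⁻¹ * ∫⁻ x, f x := by
  rw [← lintegral_map (g := fun x => C *ᵥ x) hf (by fun_prop), volume_map_mulVec hC,
    lintegral_smul_measure, smul_eq_mul]

/-- A linear map that whitens `M` carries `CN(0, M)` to the standard complex normal law. -/
lemma complexNormal_map_mulVec {ι : Type*} [Fintype ι] [DecidableEq ι] {C M : Matrix ι ι ℂ}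
    (hC : IsUnit C) (hM : C * M * Cᴴ = 1) :
    (complexNormal 0 M).map (C *ᵥ ·) = complexNormal 0 1 := by
  have hCd : IsUnit C.det := (Matrix.isUnit_iff_isUnit_det C).mp hC
  have hMinv : M⁻¹ = Cᴴ * 1 * C := by
    refine Matrix.inv_eq_left_inv ?_
    have h1 : (M * Cᴴ) * C = 1 := by
      rw [mul_eq_one_comm, ← Matrix.mul_assoc, hM]
    rw [Matrix.mul_one, mul_eq_one_comm, ← Matrix.mul_assoc, h1]
  have hdet : Complex.normSq C.det * M.det.re = 1 := by
    have := congrArg Matrix.det hM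
    rw [det_mul, det_mul, det_conjTranspose, det_one, mul_right_comm, Complex.star_def,
      Complex.mul_conj] at this
    simpa using congrArg Complex.re this
  ext s hs
  rw [Measure.map_apply (by fun_prop) hs, complexNormal, complexNormal,
    withDensity_apply _ hs, withDensity_apply _ (hs.preimage (by fun_prop)),
    ← lintegral_indicator hs, ← lintegral_indicator (hs.preimage (by fun_prop))]
  have hmeas : Measurable fun x : ι → ℂ => ENNReal.ofReal
      (Real.exp (-quadForm (1 : Matrix ι ι ℂ)⁻¹ (x - 0)) /
        (Real.pi ^ Fintype.card ι * M.det.re)) := by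
    have := continuous_quadForm (1 : Matrix ι ι ℂ)⁻¹
    fun_prop
  have h := lintegral_comp_mulVec hC (hmeas.indicator hs)
  have hpos : 0 < Complex.normSq C.det := Complex.normSq_pos.mpr hCd.ne_zero
  have hMd : M.det.re = (Complex.normSq C.det)⁻¹ := by
    exact eq_inv_of_mul_eq_one_right hdet
  calc _ = _ := lintegral_congr fun x => ?_
    _ = _ := h
    _ = _ := ?_
  · simp only [Set.indicator, Set.mem_preimage, sub_zero, inv_one, quadForm_conj, hMinv]
    rfl
  · rw [← lintegral_const_mul _ (hmeas.indicator hs)]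
    refine lintegral_congr fun x => ?_
    simp only [Set.indicator]
    split_ifs
    · rw [← ENNReal.ofReal_mul (by positivity), hMd]
      congr 1
      simp
      field_simp
    · simp

instance isProbabilityMeasure_complexNormal_one {ι : Type*} [Fintype ι] [DecidableEq ι] :
    IsProbabilityMeasure (complexNormal (0 : ι → ℂ) 1) := by
  constructor
  rw [complexNormal, withDensity_apply _ MeasurableSet.univ, setLIntegral_univ]
  have h := lintegral_exp_neg_mul_quadForm_one (ι := ι) one_pos
  have hm : Measurable fun x : ι → ℂ => ENNReal.ofReal (Real.exp (-1 * quadForm 1 x)) := by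
    have := continuous_quadForm (1 : Matrix ι ι ℂ)
    fun_prop
  calc _ = ∫⁻ x : ι → ℂ, ENNReal.ofReal (Real.pi ^ Fintype.card ι)⁻¹ *
        ENNReal.ofReal (Real.exp (-1 * quadForm 1 x)) := by
          refine lintegral_congr fun x => ?_
          rw [← ENNReal.ofReal_mul (by positivity)]
          simp [div_eq_inv_mul]
    _ = 1 := by
      rw [lintegral_const_mul _ hm, h, ← ENNReal.ofReal_mul (by positivity), div_one,
        inv_mul_cancel₀ (by positivity), ENNReal.ofReal_one]

lemma isProbabilityMeasure_complexNormal {ι : Type*} [Fintype ι] [DecidableEq ι]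
    {M : Matrix ι ι ℂ} (hM : M.PosDef) : IsProbabilityMeasure (complexNormal 0 M) := by
  obtain ⟨C, hC, hCM⟩ := exists_whitening hM
  have h := complexNormal_map_mulVec hC hCM
  have : IsProbabilityMeasure ((complexNormal 0 M).map (C *ᵥ ·)) := h ▸ inferInstance
  exact Measure.isProbabilityMeasure_of_map (μ := complexNormal 0 M) (C *ᵥ ·)

/-- The standard complex normal law on `ℂ`. -/
noncomputable def stdComplexNormal : Measure ℂ :=
  volume.withDensity fun z => ENNReal.ofReal (Real.exp (-‖z‖ ^ 2) / Real.pi)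

/-- Tonelli's theorem over a box for a product density on `ℂ ^ n`. -/
lemma lintegral_prod_ofReal {ι : Type*} [Fintype ι] {f : ℂ → ℝ} (hf : ∀ z, 0 ≤ f z)
    (hfi : Integrable f) (s : ι → Set ℂ) (hs : ∀ i, MeasurableSet (s i)) :
    ∫⁻ x in Set.univ.pi s, ENNReal.ofReal (∏ i, f (x i))
      = ∏ i, ∫⁻ z in s i, ENNReal.ofReal (f z) := by
  have hint : Integrable (fun x : ι → ℂ => ∏ i, (s i).indicator f (x i)) :=
    Integrable.fintype_prod fun i => hfi.indicator (hs i)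
  have hnn (i : ι) (z : ℂ) : 0 ≤ (s i).indicator f z := Set.indicator_nonneg (fun z _ => hf z) z
  have hind (x : ι → ℂ) : (Set.univ.pi s).indicator (fun x => ENNReal.ofReal (∏ i, f (x i))) x
      = ENNReal.ofReal (∏ i, (s i).indicator f (x i)) := by
    by_cases hx : x ∈ Set.univ.pi s
    · rw [Set.indicator_of_mem hx]
      congr 1
      refine Finset.prod_congr rfl fun i _ => ?_
      rw [Set.indicator_of_mem (hx i trivial)]
    · rw [Set.indicator_of_notMem hx]
      obtain ⟨i, hi⟩ : ∃ i, x i ∉ s i := by simpa [Set.mem_pi] using hx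
      rw [Finset.prod_eq_zero (Finset.mem_univ i) (Set.indicator_of_notMem hi f),
        ENNReal.ofReal_zero]
  rw [← lintegral_indicator (MeasurableSet.univ_pi hs), lintegral_congr hind,
    ← ofReal_integral_eq_lintegral_ofReal hint
      (ae_of_all _ fun x => Finset.prod_nonneg fun i _ => hnn i _),
    integral_fintype_prod_volume_eq_prod (fun i => (s i).indicator f),
    ENNReal.ofReal_prod_of_nonneg fun i _ => integral_nonneg (hnn i)]
  refine Finset.prod_congr rfl fun i _ => ?_
  rw [ofReal_integral_eq_lintegral_ofReal (hfi.indicator (hs i)) (ae_of_all _ (hnn i)),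
    ← lintegral_indicator (hs i)]
  refine lintegral_congr fun z => ?_
  simp only [Set.indicator]
  split_ifs <;> simp

lemma integral_exp_neg_norm_sq_div_pi :
    ∫ z : ℂ, Real.exp (-‖z‖ ^ 2) / Real.pi = 1 := by
  have h := GaussianFourier.integral_rexp_neg_mul_sq_norm (V := ℂ) one_pos
  rw [integral_div]
  simp [Complex.finrank_real_complex] at h
  rw [h, div_self Real.pi_ne_zero]

lemma integrable_exp_neg_norm_sq_div_pi :
    Integrable fun z : ℂ => Real.exp (-‖z‖ ^ 2) / Real.pi := by
  by_contra h
  simpa [integral_undef h] using integral_exp_neg_norm_sq_div_pi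

instance isProbabilityMeasure_stdComplexNormal : IsProbabilityMeasure stdComplexNormal := by
  constructor
  rw [stdComplexNormal, withDensity_apply _ MeasurableSet.univ, setLIntegral_univ,
    ← ofReal_integral_eq_lintegral_ofReal integrable_exp_neg_norm_sq_div_pi
      (ae_of_all _ fun z => by positivity),
    integral_exp_neg_norm_sq_div_pi, ENNReal.ofReal_one]

/-- The coordinates of a standard complex normal vector are independent standard complex normal
variables. -/
lemma complexNormal_eq_pi {ι : Type*} [Fintype ι] [DecidableEq ι] :
    complexNormal (0 : ι → ℂ) 1 = Measure.pi fun _ => stdComplexNormal := by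
  refine (Measure.pi_eq fun s hs => ?_).symm
  simp only [complexNormal, stdComplexNormal]
  rw [withDensity_apply _ (MeasurableSet.univ_pi hs)]
  simp_rw [withDensity_apply _ (hs _)]
  rw [← lintegral_prod_ofReal (fun z => by positivity) integrable_exp_neg_norm_sq_div_pi s hs]
  refine lintegral_congr fun x => ?_
  simp [quadForm_one, Finset.prod_div_distrib, ← Real.exp_sum]

lemma complexNormal_map_inr {ι κ : Type*} [Fintype ι] [DecidableEq ι] [Fintype κ]
    [DecidableEq κ] :
    (complexNormal (0 : ι ⊕ κ → ℂ) 1).map (fun x j => x (Sum.inr j)) = complexNormal 0 1 := by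
  simp_rw [complexNormal_eq_pi]
  have h := (measurePreserving_sumPiEquivProdPi (fun _ : ι ⊕ κ => stdComplexNormal)).map_eq
  have h2 : (fun (x : ι ⊕ κ → ℂ) j => x (Sum.inr j)) =
      Prod.snd ∘ MeasurableEquiv.sumPiEquivProdPi (fun _ : ι ⊕ κ => ℂ) := rfl
  rw [h2, ← Measure.map_map measurable_snd (MeasurableEquiv.measurable _), h,
    Measure.map_snd_prod]
  simp

lemma lintegral_complexNormal_one {ι : Type*} [Fintype ι] [DecidableEq ι]
    {f : (ι → ℂ) → ℝ} (hf : Measurable f) :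
    ∫⁻ x, ENNReal.ofReal (f x) ∂complexNormal 0 1 = ENNReal.ofReal (Real.pi ^ Fintype.card ι)⁻¹ *
      ∫⁻ x, ENNReal.ofReal (f x * Real.exp (-quadForm 1 x)) := by
  have hq := (continuous_quadForm (1 : Matrix ι ι ℂ)).measurable
  rw [complexNormal, lintegral_withDensity_eq_lintegral_mul _
    (by simp only [inv_one, sub_zero]; fun_prop) (by fun_prop),
    ← lintegral_const_mul _ (by fun_prop)]
  refine lintegral_congr fun x => ?_
  simp only [Pi.mul_apply, inv_one, sub_zero, det_one, Complex.one_re, mul_one]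
  rw [← ENNReal.ofReal_mul (by positivity), ← ENNReal.ofReal_mul (by positivity)]
  congr 1
  ring

/-- The exponential moment of a Hermitian form `1 - H` in a standard complex normal vector. For
`H = 1 - t Q` it is the Laplace transform of the form `Q`. -/
lemma lintegral_exp_one_sub_quadForm {ι : Type*} [Fintype ι] [DecidableEq ι] {H : Matrix ι ι ℂ}
    (hH : H.PosDef) :
    ∫⁻ x, ENNReal.ofReal (Real.exp (quadForm (1 - H) x)) ∂complexNormal 0 1
      = ENNReal.ofReal (H.det.re)⁻¹ := by
  have hsub (x : ι → ℂ) : quadForm (1 - H) x - quadForm 1 x = - quadForm H x := by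
    simp [quadForm, sub_mulVec]
  have hq := (continuous_quadForm (1 - H)).measurable
  have hq' := (continuous_quadForm H).measurable
  rw [lintegral_complexNormal_one (by fun_prop)]
  simp only [← Real.exp_add, ← sub_eq_add_neg, hsub]
  -- the integral is the normalization of `CN(0, H⁻¹)`
  have hp := (isProbabilityMeasure_complexNormal hH.inv).measure_univ
  rw [complexNormal, withDensity_apply _ MeasurableSet.univ, setLIntegral_univ] at hp
  have hdet : (H⁻¹).det.re = (H.det.re)⁻¹ := by
    have : (H.det.im : ℝ) = 0 := ((Complex.pos_iff.mp hH.det_pos).2).symm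
    rw [det_nonsing_inv, Ring.inverse_eq_inv', Complex.inv_re, Complex.normSq_apply, this]
    have := (det_re_pos hH).ne'
    field_simp
    simp
  have hpos := det_re_pos hH
  have hinv : H⁻¹⁻¹ = H := nonsing_inv_nonsing_inv _ ((Matrix.isUnit_iff_isUnit_det _).mp hH.isUnit)
  have : ∫⁻ x, ENNReal.ofReal (Real.exp (-quadForm H⁻¹⁻¹ (x - 0)) /
      (Real.pi ^ Fintype.card ι * H⁻¹.det.re)) = ENNReal.ofReal (H.det.re) *
      (ENNReal.ofReal (Real.pi ^ Fintype.card ι)⁻¹ *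
        ∫⁻ x, ENNReal.ofReal (Real.exp (-quadForm H x))) := by
    rw [← lintegral_const_mul _ (by fun_prop), ← lintegral_const_mul _ (by fun_prop)]
    refine lintegral_congr fun x => ?_
    rw [← ENNReal.ofReal_mul (by positivity), ← ENNReal.ofReal_mul hpos.le, hinv, hdet, sub_zero]
    congr 1
    field_simp
  rw [this] at hp
  rw [ENNReal.ofReal_inv_of_pos hpos]
  exact ENNReal.eq_inv_of_mul_eq_one_left (by rwa [mul_comm])

/-- The moment generating function of the noncentral complex chi-square law, obtained by
completing the square. -/
lemma lintegral_exp_mul_quadForm_one_add {ι : Type*} [Fintype ι] [DecidableEq ι] (μ : ι → ℂ)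
    {t : ℝ} (ht : t < 1) :
    ∫⁻ y, ENNReal.ofReal (Real.exp (t * quadForm 1 (μ + y))) ∂complexNormal 0 1
      = ENNReal.ofReal (((1 - t) ^ Fintype.card ι)⁻¹ *
          Real.exp (quadForm 1 μ * (t / (1 - t)))) := by
  have hs : 0 < 1 - t := by linarith
  have hq := (continuous_quadForm (1 : Matrix ι ι ℂ)).measurable
  -- completing the square
  have hsq (y : ι → ℂ) : t * quadForm 1 (μ + y) + -quadForm 1 y
      = quadForm 1 μ * (t / (1 - t)) + -(1 - t) * quadForm 1 (y - ((t / (1 - t) : ℝ) : ℂ) • μ) := by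
    simp only [quadForm_one, Finset.mul_sum, Finset.sum_mul, ← Finset.sum_neg_distrib,
      ← Finset.sum_add_distrib]
    refine Finset.sum_congr rfl fun i _ => ?_
    simp only [← Complex.normSq_eq_norm_sq, Complex.normSq_apply, Pi.add_apply, Pi.sub_apply,
      Pi.smul_apply, smul_eq_mul, Complex.add_re, Complex.add_im, Complex.sub_re, Complex.sub_im,
      Complex.re_ofReal_mul, Complex.im_ofReal_mul]
    field_simp
    ring
  rw [lintegral_complexNormal_one (by fun_prop)]
  simp only [← Real.exp_add, hsq]
  simp only [Real.exp_add, ENNReal.ofReal_mul (Real.exp_pos _).le]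
  rw [lintegral_const_mul _ (by fun_prop),
    lintegral_sub_right_eq_self (fun y : ι → ℂ => ENNReal.ofReal
      (Real.exp (-(1 - t) * quadForm 1 y))),
    lintegral_exp_neg_mul_quadForm_one hs, ← ENNReal.ofReal_mul (by positivity),
    ← ENNReal.ofReal_mul (by positivity)]
  congr 1
  rw [div_pow]
  field_simp

/-! ### The squared distance to a row space has a gamma law -/

/-- A finite measure on the line is determined by its Laplace transform on a half-line around the
origin: the complex moment generating function is analytic there, so that the values on the real
axis give the characteristic function. -/
lemma ext_of_lintegral_exp {μ ν : Measure ℝ} [IsFiniteMeasure μ] [IsFiniteMeasure ν]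
    (h : ∀ t < 1, ∫⁻ x, ENNReal.ofReal (Real.exp (t * x)) ∂μ
      = ∫⁻ x, ENNReal.ofReal (Real.exp (t * x)) ∂ν)
    (hfin : ∀ t < 1, ∫⁻ x, ENNReal.ofReal (Real.exp (t * x)) ∂μ ≠ ∞) : μ = ν := by
  have hint {ρ : Measure ℝ} {t : ℝ} (hρ : ∫⁻ x, ENNReal.ofReal (Real.exp (t * x)) ∂ρ ≠ ∞) :
      t ∈ integrableExpSet id ρ := by
    refine ⟨by fun_prop, ?_⟩
    rw [hasFiniteIntegral_iff_ofReal (ae_of_all _ fun x => (Real.exp_pos _).le)]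
    exact hρ.lt_top
  have hmgf (ρ : Measure ℝ) (t : ℝ) :
      mgf id ρ t = (∫⁻ x, ENNReal.ofReal (Real.exp (t * x)) ∂ρ).toReal := by
    rw [mgf, integral_eq_lintegral_of_nonneg_ae (ae_of_all _ fun x => (Real.exp_pos _).le)
      (by fun_prop)]
    rfl
  have hsub {ρ : Measure ℝ} (hρ : ∀ t < 1, ∫⁻ x, ENNReal.ofReal (Real.exp (t * x)) ∂ρ ≠ ∞) :
      {z : ℂ | z.re < 1} ⊆ {z | z.re ∈ interior (integrableExpSet id ρ)} := fun z hz =>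
    interior_maximal (fun t ht => hint (hρ t ht)) isOpen_Iio hz
  have hμ := analyticOnNhd_complexMGF.mono (hsub hfin)
  have hν := analyticOnNhd_complexMGF.mono (hsub fun t ht => h t ht ▸ hfin t ht)
  have heq : Set.EqOn (complexMGF id μ) (complexMGF id ν) {z : ℂ | z.re < 1} := by
    refine hμ.eqOn_of_preconnected_of_frequently_eq hν
      (convex_halfSpace_re_lt 1).isPreconnected (z₀ := 0) (by simp) ?_
    have hreal : ∃ᶠ x : ℝ in nhdsWithin 0 {0}ᶜ, complexMGF id μ x = complexMGF id ν x := by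
      refine Filter.Eventually.frequently ?_
      filter_upwards [mem_nhdsWithin_of_mem_nhds (Iio_mem_nhds one_pos)] with t ht
      rw [complexMGF_ofReal, complexMGF_ofReal, hmgf, hmgf, h t ht]
    refine Filter.Tendsto.frequently (f := fun x : ℝ => (x : ℂ)) ?_ hreal
    refine tendsto_nhdsWithin_iff.mpr ⟨?_, ?_⟩
    · exact (Complex.continuous_ofReal.tendsto' 0 0 (by simp)).mono_left nhdsWithin_le_nhds
    · filter_upwards [self_mem_nhdsWithin] with x hx
      simpa using hx
  refine Measure.ext_of_charFun (funext fun t => ?_)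
  rw [← complexMGF_id_mul_I, ← complexMGF_id_mul_I]
  exact heq (by simp)

lemma lintegral_exp_gammaMeasure {a t : ℝ} (ha : 0 < a) (ht : t < 1) :
    ∫⁻ x, ENNReal.ofReal (Real.exp (t * x)) ∂gammaMeasure a 1
      = ENNReal.ofReal (((1 - t) ^ a)⁻¹) := by
  have hs : 0 < 1 - t := by linarith
  have hm (r : ℝ) : Measurable (gammaPDF a r) := by
    unfold gammaPDF
    fun_prop
  rw [gammaMeasure, lintegral_withDensity_eq_lintegral_mul _ (hm 1) (by fun_prop)]
  calc _ = ∫⁻ x, ENNReal.ofReal (((1 - t) ^ a)⁻¹) * gammaPDF a (1 - t) x := by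
        refine lintegral_congr fun x => ?_
        have hr : (0 : ℝ) < (1 - t) ^ a := Real.rpow_pos_of_pos hs a
        simp only [Pi.mul_apply, gammaPDF]
        rw [← ENNReal.ofReal_mul (gammaPDFReal_nonneg ha one_pos x),
          ← ENNReal.ofReal_mul (by positivity)]
        congr 1
        simp only [gammaPDFReal]
        split_ifs
        · have : Real.exp (-((1 - t) * x)) = Real.exp (-(1 * x)) * Real.exp (t * x) := by
            rw [← Real.exp_add]; congr 1; ring
          rw [this, Real.one_rpow]
          field_simp
        · simp
    _ = _ := by
      rw [lintegral_const_mul _ (hm _), lintegral_gammaPDF_eq_one ha hs, mul_one]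

/-- When the rows of `B` are linearly independent, this is the orthogonal projection onto the kernel
of `B`, that is, onto the complement of the span of the conjugated rows. Its transpose is therefore
the projection onto the complement of the row space, and `quadForm (rowCoproj B)ᵀ a` is the squared
distance from `a` to the row space. -/
noncomputable def rowCoproj {κ ι : Type*} [Fintype κ] [DecidableEq κ] [Fintype ι] [DecidableEq ι]
    (B : Matrix κ ι ℂ) : Matrix ι ι ℂ :=
  1 - Bᴴ * (B * Bᴴ)⁻¹ * B

section rowCoproj

variable {κ ι : Type*} [Fintype κ] [DecidableEq κ] [Fintype ι] [DecidableEq ι] {B : Matrix κ ι ℂ}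

lemma rowCoproj_conjTranspose (B : Matrix κ ι ℂ) : (rowCoproj B)ᴴ = rowCoproj B := by
  simp [rowCoproj, conjTranspose_nonsing_inv, Matrix.mul_assoc]

lemma rowCoproj_mul_self (hB : (B * Bᴴ).det ≠ 0) :
    rowCoproj B * rowCoproj B = rowCoproj B := by
  have h : (B * Bᴴ) * (B * Bᴴ)⁻¹ = 1 := mul_nonsing_inv _ hB.isUnit
  have h2 : Bᴴ * (B * Bᴴ)⁻¹ * B * (Bᴴ * (B * Bᴴ)⁻¹ * B) = Bᴴ * (B * Bᴴ)⁻¹ * B := by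
    calc _ = Bᴴ * (B * Bᴴ)⁻¹ * ((B * Bᴴ) * (B * Bᴴ)⁻¹) * B := by simp only [Matrix.mul_assoc]
      _ = _ := by rw [h, Matrix.mul_one]
  simp only [rowCoproj, sub_mul, mul_sub, Matrix.one_mul, Matrix.mul_one, h2]
  abel

/-- By Sylvester's determinant identity, scaling the range of the projection by `s` has determinant
`s` to the power of its rank. -/
lemma det_one_add_smul_rowCoproj (hB : (B * Bᴴ).det ≠ 0)
    (hc : Fintype.card κ ≤ Fintype.card ι) {s : ℂ} (hs : s ≠ 0) :
    (1 + (s - 1) • rowCoproj B).det = s ^ (Fintype.card ι - Fintype.card κ) := by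
  have h : (B * Bᴴ)⁻¹ * (B * Bᴴ) = 1 := nonsing_inv_mul _ hB.isUnit
  have h1 : 1 + (s - 1) • rowCoproj B = s • (1 + Bᴴ * ((s⁻¹ - 1) • ((B * Bᴴ)⁻¹ * B))) := by
    have : s * (s⁻¹ - 1) = -(s - 1) := by field_simp; ring
    simp only [rowCoproj, smul_sub, smul_add, Matrix.mul_smul, smul_smul, this, Matrix.mul_assoc]
    rw [sub_smul, sub_smul, neg_smul, sub_smul]
    simp only [one_smul]
    abel
  have h2 : 1 + (s⁻¹ - 1) • ((B * Bᴴ)⁻¹ * B) * Bᴴ = s⁻¹ • (1 : Matrix κ κ ℂ) := by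
    rw [Matrix.smul_mul, Matrix.mul_assoc, h, sub_smul, one_smul]
    abel
  rw [h1, det_smul, det_one_add_mul_comm, h2, det_smul, det_one, mul_one, pow_sub₀ _ hs hc,
    inv_pow]

/-- A square root of `1 - t Q`, for the projection `Q`. -/
lemma one_sub_smul_rowCoproj_eq (hB : (B * Bᴴ).det ≠ 0) {t : ℝ} (ht : t < 1) :
    1 - (t : ℂ) • rowCoproj B =
      (1 + ((√(1 - t) : ℂ) - 1) • rowCoproj B) * (1 + ((√(1 - t) : ℂ) - 1) • rowCoproj B) := by
  have h : (√(1 - t) : ℂ) * √(1 - t) = 1 - t := by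
    rw [← Complex.ofReal_mul, Real.mul_self_sqrt (by linarith)]
    simp
  simp only [add_mul, mul_add, Matrix.one_mul, Matrix.mul_one, smul_mul_smul_comm,
    rowCoproj_mul_self hB]
  rw [add_assoc, ← add_smul, ← add_smul, sub_eq_add_neg, ← neg_smul]
  congr 2
  linear_combination -h

lemma one_sub_smul_rowCoproj_posDef (hB : (B * Bᴴ).det ≠ 0)
    (hc : Fintype.card κ ≤ Fintype.card ι) {t : ℝ} (ht : t < 1) :
    (1 - (t : ℂ) • rowCoproj B).PosDef := by
  have hs : (√(1 - t) : ℂ) ≠ 0 := by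
    simpa using (Real.sqrt_pos.mpr (by linarith : 0 < 1 - t)).ne'
  set C := 1 + ((√(1 - t) : ℂ) - 1) • rowCoproj B with hCdef
  have hC : Cᴴ = C := by
    simp [hCdef, rowCoproj_conjTranspose]
  have hCu : IsUnit C := by
    rw [Matrix.isUnit_iff_isUnit_det, hCdef, det_one_add_smul_rowCoproj hB hc hs]
    exact (pow_ne_zero _ hs).isUnit
  rw [one_sub_smul_rowCoproj_eq hB ht]
  have := PosDef.conjTranspose_mul_self C (mulVec_injective_of_isUnit hCu)
  rwa [hC] at this

lemma det_one_sub_smul_rowCoproj (hB : (B * Bᴴ).det ≠ 0)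
    (hc : Fintype.card κ ≤ Fintype.card ι) {t : ℝ} (ht : t < 1) :
    (1 - (t : ℂ) • rowCoproj B).det = ((1 - t) ^ (Fintype.card ι - Fintype.card κ) : ℝ) := by
  have hs : (√(1 - t) : ℂ) ≠ 0 := by
    simpa using (Real.sqrt_pos.mpr (by linarith : 0 < 1 - t)).ne'
  rw [one_sub_smul_rowCoproj_eq hB ht, det_mul, det_one_add_smul_rowCoproj hB hc hs, ← mul_pow,
    ← Complex.ofReal_mul, Real.mul_self_sqrt (by linarith), Complex.ofReal_pow]

/-- The squared distance of a standard complex normal vector from a subspace has a gamma law, whose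
shape is the complex codimension. -/
lemma map_quadForm_rowCoproj (hB : (B * Bᴴ).det ≠ 0) (hc : Fintype.card κ < Fintype.card ι) :
    (complexNormal (0 : ι → ℂ) 1).map (quadForm (rowCoproj B)ᵀ)
      = gammaMeasure (Fintype.card ι - Fintype.card κ : ℕ) 1 := by
  have hd : (0 : ℝ) < (Fintype.card ι - Fintype.card κ : ℕ) := by
    exact_mod_cast Nat.sub_pos_of_lt hc
  have hq := (continuous_quadForm (rowCoproj B)ᵀ).measurable
  have := isProbabilityMeasure_gammaMeasure hd one_pos
  have := Measure.isProbabilityMeasure_map (μ := complexNormal (0 : ι → ℂ) 1) hq.aemeasurable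
  have key {t : ℝ} (ht : t < 1) :
      ∫⁻ x, ENNReal.ofReal (Real.exp (t * x))
        ∂(complexNormal (0 : ι → ℂ) 1).map (quadForm (rowCoproj B)ᵀ)
      = ENNReal.ofReal (((1 - t) ^ (Fintype.card ι - Fintype.card κ))⁻¹) := by
    have h1 (x : ι → ℂ) : t * quadForm (rowCoproj B)ᵀ x
        = quadForm (1 - (1 - (t : ℂ) • rowCoproj B)ᵀ) x := by
      simp [quadForm, smul_mulVec, transpose_sub, transpose_smul]
    rw [lintegral_map (by fun_prop) hq]
    simp_rw [h1]
    rw [lintegral_exp_one_sub_quadForm (one_sub_smul_rowCoproj_posDef hB hc.le ht).transpose,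
      det_transpose, det_one_sub_smul_rowCoproj hB hc.le ht, Complex.ofReal_re]
  refine ext_of_lintegral_exp (fun t ht => ?_) (fun t ht => ?_)
  · rw [key ht, lintegral_exp_gammaMeasure hd ht, Real.rpow_natCast]
  · rw [key ht]
    exact ENNReal.ofReal_ne_top

end rowCoproj

/-! ### Inverse Gram matrices -/

section rows

variable {m : ℕ} {ι : Type*} [Fintype ι] [DecidableEq ι]

lemma dotProduct_rowCoproj {κ : Type*} [Fintype κ] [DecidableEq κ] (B : Matrix κ ι ℂ) (a : ι → ℂ) :
    a ⬝ᵥ rowCoproj B *ᵥ star a = quadForm (rowCoproj B)ᵀ a := by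
  have h1 : star a ⬝ᵥ (rowCoproj B)ᵀ *ᵥ a = a ⬝ᵥ rowCoproj B *ᵥ star a := by
    rw [mulVec_transpose, dotProduct_comm, dotProduct_mulVec]
  have h2 : star (a ⬝ᵥ rowCoproj B *ᵥ star a) = a ⬝ᵥ rowCoproj B *ᵥ star a := by
    rw [← star_dotProduct_star, star_mulVec, star_star, rowCoproj_conjTranspose,
      dotProduct_comm, dotProduct_mulVec, dotProduct_comm]
  rw [quadForm, h1]
  exact (Complex.conj_eq_iff_re.mp h2).symm

lemma mul_rowCoproj {κ : Type*} [Fintype κ] [DecidableEq κ] {B : Matrix κ ι ℂ}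
    (hB : (B * Bᴴ).det ≠ 0) : B * rowCoproj B = 0 := by
  have h : (B * Bᴴ) * (B * Bᴴ)⁻¹ = 1 := mul_nonsing_inv _ hB.isUnit
  rw [rowCoproj, Matrix.mul_sub, Matrix.mul_one, ← Matrix.mul_assoc, ← Matrix.mul_assoc, h,
    Matrix.one_mul, sub_self]

/-- All rows of a matrix but the first. -/
def tailRows (W : Matrix (Fin (m + 1)) ι ℂ) : Matrix (Fin m) ι ℂ := W.submatrix Fin.succ id

variable {W : Matrix (Fin (m + 1)) ι ℂ}

omit [Fintype ι] [DecidableEq ι] in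
lemma vecMul_eq_add_tailRows (W : Matrix (Fin (m + 1)) ι ℂ) (x : Fin (m + 1) → ℂ) :
    x ᵥ* W = x 0 • W 0 + (fun i => x i.succ) ᵥ* tailRows W := by
  ext j
  simp only [vecMul, dotProduct, Fin.sum_univ_succ, Pi.add_apply, Pi.smul_apply, smul_eq_mul,
    tailRows, submatrix_apply, id_eq]

/-- A new row at nonzero distance from the span of linearly independent rows keeps the Gram matrix
positive definite. -/
lemma posDef_of_tailRows (hB : (tailRows W * (tailRows W)ᴴ).det ≠ 0)
    (ha : quadForm (rowCoproj (tailRows W))ᵀ (W 0) ≠ 0) : (W * Wᴴ).PosDef := by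
  refine PosDef.mul_conjTranspose_self _ ?_
  refine (injective_iff_map_eq_zero W.vecMulLinear).mpr fun x hx => ?_
  rw [vecMulLinear_apply, vecMul_eq_add_tailRows] at hx
  have hc : x 0 = 0 := by
    have h := congrArg (fun w => w ⬝ᵥ rowCoproj (tailRows W) *ᵥ star (W 0)) hx
    simp only [add_dotProduct, smul_dotProduct, zero_dotProduct, dotProduct_rowCoproj] at h
    rw [dotProduct_mulVec, vecMul_vecMul, mul_rowCoproj hB] at h
    simpa [ha] using h
  rw [hc, zero_smul, zero_add] at hx
  have h := congrArg (fun w => (w ᵥ* (tailRows W)ᴴ) ᵥ* (tailRows W * (tailRows W)ᴴ)⁻¹) hx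
  simp only [vecMul_vecMul, mul_nonsing_inv _ hB.isUnit, vecMul_one, zero_vecMul] at h
  ext i
  exact Fin.cases hc (fun i => congrFun h i) i

/-- The upper left entry of the inverse Gram matrix is the inverse squared distance of the first row
to the span of the others. -/
lemma quadForm_inv_single_zero (hB : (tailRows W * (tailRows W)ᴴ).det ≠ 0)
    (ha : quadForm (rowCoproj (tailRows W))ᵀ (W 0) ≠ 0) (c : ℝ) :
    quadForm (W * Wᴴ)⁻¹ (Pi.single 0 (c : ℂ))
      = c ^ 2 / quadForm (rowCoproj (tailRows W))ᵀ (W 0) := by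
  set B := tailRows W with hBdef
  set s := quadForm (rowCoproj B)ᵀ (W 0) with hs
  have hsC : (s : ℂ) ≠ 0 := by exact_mod_cast ha
  have hdet := ((Matrix.isUnit_iff_isUnit_det _).mp (posDef_of_tailRows hB ha).isUnit)
  -- the combination of the rows that is orthogonal to all of them but the first
  let x : Fin (m + 1) → ℂ := Fin.cons 1 (-((B * Bᴴ)⁻¹ *ᵥ (B *ᵥ star (W 0))))
  have h1 : Wᴴ *ᵥ x = rowCoproj B *ᵥ star (W 0) := by
    have h := vecMul_eq_add_tailRows W (star x)
    have h' : Wᴴ *ᵥ x = star (W 0) + Bᴴ *ᵥ (-((B * Bᴴ)⁻¹ *ᵥ (B *ᵥ star (W 0)))) := by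
      rw [← star_star (Wᴴ *ᵥ x), star_mulVec, conjTranspose_conjTranspose, h, star_add, star_smul,
        ← hBdef, star_vecMul]
      simp only [Pi.star_apply, x, Fin.cons_zero, star_one, one_smul, Fin.cons_succ]
      congr 2
      ext i
      simp
    rw [h', rowCoproj, sub_mulVec, one_mulVec, mulVec_neg, ← sub_eq_add_neg, mulVec_mulVec,
      mulVec_mulVec]
  have h2 : (W * Wᴴ) *ᵥ x = Pi.single 0 (s : ℂ) := by
    rw [← mulVec_mulVec, h1]
    ext i
    refine Fin.cases ?_ (fun i => ?_) i
    · rw [Pi.single_eq_same, hs, ← dotProduct_rowCoproj]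
      rfl
    · have := congrFun (congrArg (fun M => M *ᵥ star (W 0)) (mul_rowCoproj hB)) i
      rw [← mulVec_mulVec, zero_mulVec] at this
      rw [Pi.single_eq_of_ne (Fin.succ_ne_zero i)]
      exact this
  have h3 : (W * Wᴴ)⁻¹ *ᵥ Pi.single 0 (c : ℂ) = ((c / s : ℝ) : ℂ) • x := by
    have h4 : Pi.single (0 : Fin (m + 1)) (c : ℂ) = ((c / s : ℝ) : ℂ) • Pi.single 0 (s : ℂ) := by
      rw [← Pi.single_smul]
      congr 1
      push_cast
      rw [smul_eq_mul, div_mul_cancel₀ _ hsC]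
    rw [h4, mulVec_smul, ← h2, mulVec_mulVec, nonsing_inv_mul _ hdet, one_mulVec]
  have h5 : star (Pi.single (0 : Fin (m + 1)) (c : ℂ) : Fin (m + 1) → ℂ) = Pi.single 0 (c : ℂ) := by
    rw [← Pi.single_star, Complex.star_def, Complex.conj_ofReal]
  rw [quadForm, h3, h5, single_dotProduct, Pi.smul_apply, smul_eq_mul]
  simp only [x, Fin.cons_zero, mul_one]
  rw [← Complex.ofReal_mul, Complex.ofReal_re]
  ring

end rows

lemma measurable_det_of_entries {X ι : Type*} [MeasurableSpace X] [Fintype ι] [DecidableEq ι]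
    {N : X → Matrix ι ι ℂ} (hN : ∀ i j, Measurable fun x => N x i j) :
    Measurable fun x => (N x).det := by
  simp only [det_apply]
  exact Finset.measurable_sum _ fun σ _ =>
    (Finset.measurable_prod _ fun i _ => hN _ _).const_smul _

lemma measurable_quadForm_inv {X ι : Type*} [MeasurableSpace X] [Fintype ι] [DecidableEq ι]
    {M : X → Matrix ι ι ℂ} (hM : ∀ i j, Measurable fun x => M x i j) {v : X → ι → ℂ}
    (hv : ∀ i, Measurable fun x => v x i) : Measurable fun x => quadForm (M x)⁻¹ (v x) := by
  have hadj (i j : ι) : Measurable fun x => (M x).adjugate i j := by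
    simp only [adjugate_apply]
    refine measurable_det_of_entries fun k l => ?_
    simp only [updateRow_apply]
    split_ifs
    · exact measurable_const
    · exact hM k l
  have hd := measurable_det_of_entries hM
  simp only [quadForm, inv_def, dotProduct, mulVec, Matrix.smul_apply, smul_eq_mul,
    Ring.inverse_eq_inv', Pi.star_apply]
  refine Complex.measurable_re.comp (Finset.measurable_sum _ fun i _ => ?_)
  refine (continuous_star.measurable.comp (hv i)).mul (Finset.measurable_sum _ fun j _ => ?_)
  exact (hd.inv.mul (hadj i j)).mul (hv j)

/-- Transposing an array of independent standard complex normal entries. -/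
lemma pi_complexNormal_map_swap {κ ι : Type*} [Fintype κ] [DecidableEq κ] [Fintype ι]
    [DecidableEq ι] :
    (Measure.pi fun _ : κ => complexNormal (0 : ι → ℂ) 1).map (fun z i k => z k i)
      = Measure.pi fun _ : ι => complexNormal (0 : κ → ℂ) 1 := by
  simp_rw [complexNormal_eq_pi, ← Measure.infinitePi_eq_pi]
  rw [← Measure.infinitePi_map_curry (fun (_ : ι) (_ : κ) => stdComplexNormal),
    ← Measure.infinitePi_map_curry (fun (_ : κ) (_ : ι) => stdComplexNormal),
    ← Measure.infinitePi_map_piCongrLeft (fun _ : ι × κ => stdComplexNormal) (Equiv.prodComm κ ι),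
    Measure.map_map (by fun_prop) (by fun_prop), Measure.map_map (by fun_prop) (by fun_prop)]
  congr 1

/-! ### Random Gram and scatter matrices -/

/-- Splitting off the first row of a matrix with independent standard complex normal rows. -/
lemma measurePreserving_tailRows (m : ℕ) {ι : Type*} [Fintype ι] [DecidableEq ι] :
    MeasurePreserving (fun W : Fin (m + 1) → ι → ℂ => (W 0, fun i : Fin m => W i.succ))
      (Measure.pi fun _ => complexNormal 0 1)
      ((complexNormal 0 1).prod (Measure.pi fun _ => complexNormal 0 1)) :=
  measurePreserving_piFinSuccAbove (fun _ : Fin (m + 1) => complexNormal (0 : ι → ℂ) 1) 0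

lemma measurable_quadForm_rowCoproj {κ ι : Type*} [Fintype κ] [DecidableEq κ] [Fintype ι]
    [DecidableEq ι] : Measurable fun p : (ι → ℂ) × (κ → ι → ℂ) =>
      quadForm (rowCoproj (Matrix.of p.2))ᵀ p.1 := by
  have h (p : (ι → ℂ) × (κ → ι → ℂ)) : quadForm (rowCoproj (Matrix.of p.2))ᵀ p.1
      = quadForm 1 p.1 - quadForm (Matrix.of p.2 * (Matrix.of p.2)ᴴ)⁻¹
          (Matrix.of p.2 *ᵥ star p.1) := by
    have h1 := dotProduct_rowCoproj (Matrix.of p.2) p.1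
    have h2 := congrArg Complex.re h1
    rw [Complex.ofReal_re] at h2
    rw [← h2, rowCoproj, sub_mulVec, dotProduct_sub, Complex.sub_re, quadForm, quadForm,
      one_mulVec, one_mulVec, dotProduct_comm, star_mulVec, star_star, ← mulVec_mulVec,
      ← mulVec_mulVec, ← dotProduct_mulVec]
  simp_rw [h]
  refine ((continuous_quadForm 1).measurable.comp measurable_fst).sub
    (measurable_quadForm_inv (fun i j => ?_) fun i => ?_)
  · simp only [mul_apply, conjTranspose_apply, Matrix.of_apply]
    exact Finset.measurable_sum _ fun k _ => (by fun_prop : Measurable _).mul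
      (continuous_star.measurable.comp (by fun_prop))
  · simp only [mulVec, dotProduct, Matrix.of_apply, Pi.star_apply]
    exact Finset.measurable_sum _ fun k _ => (by fun_prop : Measurable _).mul
      (continuous_star.measurable.comp (by fun_prop))

lemma ae_quadForm_rowCoproj_ne_zero {κ ι : Type*} [Fintype κ] [DecidableEq κ] [Fintype ι]
    [DecidableEq ι] {B : Matrix κ ι ℂ} (hB : (B * Bᴴ).det ≠ 0)
    (hc : Fintype.card κ < Fintype.card ι) :
    ∀ᵐ a ∂complexNormal 0 1, quadForm (rowCoproj B)ᵀ a ≠ 0 := by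
  refine ae_of_ae_map (continuous_quadForm _).aemeasurable (p := fun x => x ≠ 0) ?_
  rw [map_quadForm_rowCoproj hB hc, gammaMeasure]
  refine (withDensity_absolutelyContinuous _ _).ae_le ?_
  exact compl_mem_ae_iff.mpr (measure_singleton 0)

lemma ae_prod_rowCoproj {m : ℕ} {ι : Type*} [Fintype ι] [DecidableEq ι]
    (hm : m < Fintype.card ι)
    (h : ∀ᵐ B ∂Measure.pi fun _ : Fin m => complexNormal (0 : ι → ℂ) 1,
      (Matrix.of B * (Matrix.of B)ᴴ).PosDef) :
    ∀ᵐ p ∂(complexNormal (0 : ι → ℂ) 1).prod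
        (Measure.pi fun _ : Fin m => complexNormal (0 : ι → ℂ) 1),
      (Matrix.of p.2 * (Matrix.of p.2)ᴴ).det ≠ 0 ∧
        quadForm (rowCoproj (Matrix.of p.2))ᵀ p.1 ≠ 0 := by
  have hmeas : MeasurableSet {p : (ι → ℂ) × (Fin m → ι → ℂ) |
      (Matrix.of p.2 * (Matrix.of p.2)ᴴ).det ≠ 0 ∧
      quadForm (rowCoproj (Matrix.of p.2))ᵀ p.1 ≠ 0} := by
    refine (measurableSet_eq_fun (measurable_det_of_entries fun i j => ?_)
      measurable_const).compl.inter
      (measurableSet_eq_fun measurable_quadForm_rowCoproj measurable_const).compl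
    simp only [mul_apply, conjTranspose_apply, Matrix.of_apply]
    exact Finset.measurable_sum _ fun k _ => (by fun_prop : Measurable _).mul
      (continuous_star.measurable.comp (by fun_prop))
  rw [← Measure.prod_swap, ae_map_iff measurable_swap.aemeasurable hmeas,
    Measure.ae_prod_iff_ae_ae (p := fun p : (Fin m → ι → ℂ) × (ι → ℂ) =>
      (Matrix.of p.swap.2 * (Matrix.of p.swap.2)ᴴ).det ≠ 0 ∧
        quadForm (rowCoproj (Matrix.of p.swap.2))ᵀ p.swap.1 ≠ 0) (measurable_swap hmeas)]
  filter_upwards [h] with B hB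
  have hBd : (Matrix.of B * (Matrix.of B)ᴴ).det ≠ 0 := hB.det_pos.ne'
  filter_upwards [ae_quadForm_rowCoproj_ne_zero hBd (by simpa using hm)] with a ha
  exact ⟨hBd, ha⟩

/-- By induction on the number of rows: the squared distance of a new row to the span of the
previous ones has a gamma law, hence is almost surely nonzero. -/
lemma ae_posDef_mul_conjTranspose {m : ℕ} {ι : Type*} [Fintype ι] [DecidableEq ι]
    (hm : m ≤ Fintype.card ι) :
    ∀ᵐ W ∂Measure.pi fun _ : Fin m => complexNormal (0 : ι → ℂ) 1,
      (Matrix.of W * (Matrix.of W)ᴴ).PosDef := by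
  induction m with
  | zero =>
    exact ae_of_all _ fun W => .of_dotProduct_mulVec_pos (Subsingleton.elim _ _)
      fun x hx => (hx (Subsingleton.elim _ _)).elim
  | succ m ih =>
    filter_upwards [(measurePreserving_tailRows m).quasiMeasurePreserving.ae
      (ae_prod_rowCoproj hm (ih (by omega)))] with W hW
    exact posDef_of_tailRows (W := Matrix.of W) hW.1 hW.2

/-- A unitary matrix that rotates a given vector onto the first coordinate axis. -/
lemma exists_unitary_mulVec_eq_single {m : ℕ} {v : Fin (m + 1) → ℂ} (hv : v ≠ 0) :
    ∃ U : Matrix (Fin (m + 1)) (Fin (m + 1)) ℂ, U * Uᴴ = 1 ∧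
      U *ᵥ v = Pi.single 0 ((√(quadForm 1 v) : ℝ) : ℂ) := by
  let w : EuclideanSpace ℂ (Fin (m + 1)) := WithLp.toLp 2 v
  have hw : w ≠ 0 := fun h => hv (by simpa [w] using h)
  have hwn : ‖w‖ = √(quadForm 1 v) := by
    rw [EuclideanSpace.norm_eq, quadForm_one]
  have ho : Orthonormal ℂ (({0} : Set (Fin (m + 1))).domRestrict
      fun _ : Fin (m + 1) => ((‖w‖⁻¹ : ℝ) : ℂ) • w) := by
    refine ⟨fun i => ?_, fun i j hij => (hij (Subsingleton.elim i j)).elim⟩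
    rw [Set.domRestrict_apply, norm_smul, Complex.norm_real, norm_inv, norm_norm]
    exact inv_mul_cancel₀ (norm_ne_zero_iff.mpr hw)
  obtain ⟨b, hb⟩ := ho.exists_orthonormalBasis_extension_of_card_eq (by simp)
  have hb0 : w = ((‖w‖ : ℝ) : ℂ) • b 0 := by
    rw [hb 0 rfl, smul_smul, ← Complex.ofReal_mul, mul_inv_cancel₀ (norm_ne_zero_iff.mpr hw)]
    simp
  have hinner (i j : Fin (m + 1)) : ∑ k, star (b i k) * b j k = if i = j then 1 else 0 := by
    rw [← orthonormal_iff_ite.mp b.orthonormal i j, PiLp.inner_apply]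
    simp [mul_comm]
  refine ⟨Matrix.of fun i j => star (b i j), ?_, ?_⟩
  · ext i j
    simp only [mul_apply, conjTranspose_apply, Matrix.of_apply, star_star, hinner, one_apply]
  · ext i
    have hvj (j : Fin (m + 1)) : v j = ((‖w‖ : ℝ) : ℂ) * b 0 j := by
      simpa [w] using congrArg (fun u : EuclideanSpace ℂ (Fin (m + 1)) => u j) hb0
    simp only [mulVec, dotProduct, Matrix.of_apply, hvj]
    simp_rw [mul_left_comm _ ((‖w‖ : ℝ) : ℂ)]
    rw [← Finset.mul_sum, hinner, ← hwn, Pi.single_apply]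
    split_ifs <;> simp

lemma scatterMatrix_eq {ι : Type*} {K : ℕ} (zs : Fin K → ι → ℂ) :
    scatterMatrix zs = Matrix.of (fun a k => zs k a) * (Matrix.of fun a k => zs k a)ᴴ := rfl

lemma scatterMatrix_mulVec {ι κ : Type*} [Fintype ι] {K : ℕ} (C : Matrix κ ι ℂ)
    (zs : Fin K → ι → ℂ) :
    scatterMatrix (fun k => C *ᵥ zs k) = C * scatterMatrix zs * Cᴴ := by
  have h : (Matrix.of fun a k => (C *ᵥ zs k) a) = C * Matrix.of fun a k => zs k a := by
    ext a k
    rfl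
  rw [scatterMatrix_eq, scatterMatrix_eq, h, conjTranspose_mul]
  simp only [Matrix.mul_assoc]

/-- The form `vᴴ S⁻¹ v` is invariant under invertible linear changes of the data. -/
lemma quadForm_inv_congr {ι : Type*} [Fintype ι] [DecidableEq ι] {C : Matrix ι ι ℂ}
    (hC : IsUnit C) (S : Matrix ι ι ℂ) (v : ι → ℂ) :
    quadForm (C * S * Cᴴ)⁻¹ (C *ᵥ v) = quadForm S⁻¹ v := by
  have h1 : C⁻¹ * C = 1 := nonsing_inv_mul _ ((Matrix.isUnit_iff_isUnit_det C).mp hC)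
  have h2 : Cᴴ * (Cᴴ)⁻¹ = 1 := by
    rw [← conjTranspose_nonsing_inv, ← conjTranspose_mul, h1, conjTranspose_one]
  rw [quadForm_conj, Matrix.mul_inv_rev, Matrix.mul_inv_rev]
  congr 1
  calc Cᴴ * ((Cᴴ)⁻¹ * (S⁻¹ * C⁻¹)) * C = (Cᴴ * (Cᴴ)⁻¹) * S⁻¹ * (C⁻¹ * C) := by
        simp only [Matrix.mul_assoc]
    _ = S⁻¹ := by rw [h1, h2, Matrix.one_mul, Matrix.mul_one]

lemma measurable_scatterMatrix_apply {ι : Type*} {K : ℕ} (i j : ι) :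
    Measurable fun zs : Fin K → ι → ℂ => scatterMatrix zs i j := by
  simp only [scatterMatrix_eq, mul_apply, conjTranspose_apply, Matrix.of_apply]
  exact Finset.measurable_sum _ fun k _ => (by fun_prop : Measurable _).mul
    (continuous_star.measurable.comp (by fun_prop))

lemma pi_complexNormal_map_mulVec {ι : Type*} [Fintype ι] [DecidableEq ι] {K : ℕ}
    {C M : Matrix ι ι ℂ} (hC : IsUnit C) (hM : M.PosDef) (hCM : C * M * Cᴴ = 1) :
    (Measure.pi fun _ : Fin K => complexNormal 0 M).map (fun zs k => C *ᵥ zs k)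
      = Measure.pi fun _ : Fin K => complexNormal 0 1 := by
  have := isProbabilityMeasure_complexNormal hM
  have h := complexNormal_map_mulVec hC hCM
  have hp : IsProbabilityMeasure ((complexNormal 0 M).map (C *ᵥ ·)) := h ▸ inferInstance
  rw [Measure.pi_map_pi (f := fun _ : Fin K => (C *ᵥ ·)) fun _ =>
    (by fun_prop : Measurable (C *ᵥ ·)).aemeasurable, h]

/-- For a fixed `v`, the ratio of `‖v‖²` to `vᴴ S⁻¹ v` has a gamma law of shape `K - m`, where
`S` is the scatter matrix of `K` standard complex normal vectors of dimension `m + 1`. -/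
lemma lintegral_quadForm_scatterMatrix_inv {K m : ℕ} (hK : m + 1 ≤ K) {v : Fin (m + 1) → ℂ}
    (hv : v ≠ 0) {f : ℝ → ℝ≥0∞} (hf : Measurable f) :
    ∫⁻ zs, f (quadForm (scatterMatrix zs)⁻¹ v)
        ∂Measure.pi (fun _ : Fin K => complexNormal (0 : Fin (m + 1) → ℂ) 1)
      = ∫⁻ g, f (quadForm 1 v / g) ∂gammaMeasure (K - m : ℕ) 1 := by
  obtain ⟨U, hU, hUv⟩ := exists_unitary_mulVec_eq_single hv
  have hUu : IsUnit U := IsUnit.of_mul_eq_one _ hU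
  have hq : 0 ≤ quadForm 1 v := by
    rw [quadForm_one]
    positivity
  set e : Fin (m + 1) → ℂ := Pi.single 0 ((√(quadForm 1 v) : ℝ) : ℂ) with he
  have hF : Measurable fun zs : Fin K → Fin (m + 1) → ℂ =>
      f (quadForm (scatterMatrix zs)⁻¹ e) :=
    hf.comp (measurable_quadForm_inv measurable_scatterMatrix_apply fun i => measurable_const)
  have hG : Measurable fun W : Fin (m + 1) → Fin K → ℂ =>
      f (quadForm (Matrix.of W * (Matrix.of W)ᴴ)⁻¹ e) := by
    refine hf.comp (measurable_quadForm_inv (fun i j => ?_) fun i => measurable_const)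
    simp only [mul_apply, conjTranspose_apply, Matrix.of_apply]
    exact Finset.measurable_sum _ fun k _ => (by fun_prop : Measurable _).mul
      (continuous_star.measurable.comp (by fun_prop))
  have hH : Measurable fun p : (Fin K → ℂ) × (Fin m → Fin K → ℂ) =>
      f (quadForm 1 v / quadForm (rowCoproj (Matrix.of p.2))ᵀ p.1) :=
    hf.comp (measurable_const.div measurable_quadForm_rowCoproj)
  calc ∫⁻ zs, f (quadForm (scatterMatrix zs)⁻¹ v)
        ∂Measure.pi (fun _ : Fin K => complexNormal (0 : Fin (m + 1) → ℂ) 1)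
      = ∫⁻ zs, f (quadForm (scatterMatrix fun k => U *ᵥ zs k)⁻¹ e)
        ∂Measure.pi (fun _ : Fin K => complexNormal (0 : Fin (m + 1) → ℂ) 1) := by
        refine lintegral_congr fun zs => ?_
        rw [scatterMatrix_mulVec, ← hUv, quadForm_inv_congr hUu]
    _ = ∫⁻ zs, f (quadForm (scatterMatrix zs)⁻¹ e)
        ∂Measure.pi (fun _ : Fin K => complexNormal (0 : Fin (m + 1) → ℂ) 1) := by
        conv_rhs => rw [← pi_complexNormal_map_mulVec hUu .one (by rwa [Matrix.mul_one])]
        rw [lintegral_map hF (by fun_prop)]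
    _ = ∫⁻ W, f (quadForm (Matrix.of W * (Matrix.of W)ᴴ)⁻¹ e)
        ∂Measure.pi (fun _ : Fin (m + 1) => complexNormal (0 : Fin K → ℂ) 1) := by
        conv_rhs => rw [← pi_complexNormal_map_swap]
        exact (lintegral_map (g := fun (z : Fin K → Fin (m + 1) → ℂ) i k => z k i) hG
          (by fun_prop)).symm
    _ = ∫⁻ W, f (quadForm 1 v / quadForm (rowCoproj (Matrix.of fun i : Fin m => W i.succ))ᵀ (W 0))
        ∂Measure.pi (fun _ : Fin (m + 1) => complexNormal (0 : Fin K → ℂ) 1) := by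
        refine lintegral_congr_ae ?_
        have hB := (measurePreserving_tailRows m (ι := Fin K)).quasiMeasurePreserving.ae
          (ae_prod_rowCoproj (by simpa using hK)
            (ae_posDef_mul_conjTranspose (m := m) (ι := Fin K) (by simp; omega)))
        filter_upwards [hB] with W hW
        rw [he, quadForm_inv_single_zero (W := Matrix.of W) hW.1 hW.2, Real.sq_sqrt hq]
        rfl
    _ = ∫⁻ p, f (quadForm 1 v / quadForm (rowCoproj (Matrix.of p.2))ᵀ p.1)
        ∂(complexNormal (0 : Fin K → ℂ) 1).prod
          (Measure.pi fun _ : Fin m => complexNormal (0 : Fin K → ℂ) 1) := by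
        rw [← (measurePreserving_tailRows m).lintegral_comp hH]
    _ = ∫⁻ _ : Fin m → Fin K → ℂ, (∫⁻ g, f (quadForm 1 v / g) ∂gammaMeasure (K - m : ℕ) 1)
        ∂Measure.pi fun _ : Fin m => complexNormal (0 : Fin K → ℂ) 1 := by
        rw [lintegral_prod_symm _ hH.aemeasurable]
        refine lintegral_congr_ae ?_
        filter_upwards [ae_posDef_mul_conjTranspose (m := m) (ι := Fin K) (by simp; omega)]
          with B hB
        have h := map_quadForm_rowCoproj hB.det_pos.ne' (by simpa using hK)
        rw [Fintype.card_fin, Fintype.card_fin] at h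
        rw [← h, lintegral_map (f := fun g => f (quadForm 1 v / g)) (hf.comp (by fun_prop))
          (continuous_quadForm _).measurable]
    _ = _ := by
        rw [lintegral_const, measure_univ, mul_one]

/-! ### Moments of the noncentral chi-square law and the ratio law -/

/-- The coefficients of the polynomials that appear in the derivatives of the moment generating
function of the noncentral complex chi-square law with `m + 1` complex degrees of freedom. -/
noncomputable def momentCoeff (m n k : ℕ) : ℝ :=
  (n.choose k : ℝ) * (((m + n)! : ℝ) / ((m + k)! : ℝ))

lemma momentCoeff_succ_zero (m n : ℕ) :
    momentCoeff m (n + 1) 0 = (m + 1 + n) * momentCoeff m n 0 := by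
  simp only [momentCoeff, ← add_assoc, Nat.factorial_succ, Nat.choose_zero_right]
  push_cast
  ring

lemma momentCoeff_succ_succ (m n k : ℕ) :
    momentCoeff m (n + 1) (k + 1)
      = (m + 1 + n + (k + 1)) * momentCoeff m n (k + 1) + momentCoeff m n k := by
  have h : (n.choose (k + 1) : ℝ) * (k + 1) = n.choose k * (n - k) := by
    rcases le_or_gt k n with hkn | hkn
    · have := congrArg (Nat.cast (R := ℝ)) (Nat.choose_succ_right_eq n k)
      push_cast [Nat.cast_sub hkn] at this
      exact this
    · simp [Nat.choose_eq_zero_of_lt hkn, Nat.choose_eq_zero_of_lt (Nat.lt_succ_of_lt hkn)]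
  simp only [momentCoeff, ← add_assoc, Nat.factorial_succ, Nat.choose_succ_succ']
  push_cast
  have h1 : ((m + k)! : ℝ) ≠ 0 := by positivity
  have h2 : (m + k + 1 : ℝ) ≠ 0 := by positivity
  field_simp
  linear_combination -h

/-- A closed form, valid for `t < 1`, of the `n`-th derivative of
`t ↦ (1 - t) ^ (-(m + 1)) * exp (δ t / (1 - t))`. -/
noncomputable def chiSqMGFDeriv (m : ℕ) (δ : ℝ) (n : ℕ) (t : ℝ) : ℝ :=
  (∑ k ∈ Finset.range (n + 1), momentCoeff m n k * δ ^ k * ((1 - t)⁻¹) ^ (m + 1 + n + k))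
    * Real.exp (δ * (t / (1 - t)))

lemma hasDerivAt_chiSqMGFDeriv (m : ℕ) (δ : ℝ) (n : ℕ) {t : ℝ} (ht : t < 1) :
    HasDerivAt (chiSqMGFDeriv m δ n) (chiSqMGFDeriv m δ (n + 1) t) t := by
  have hs : 1 - t ≠ 0 := by linarith
  have hinv : HasDerivAt (fun t : ℝ => (1 - t)⁻¹) (((1 - t)⁻¹) ^ 2) t := by
    have := ((hasDerivAt_id t).const_sub 1).inv hs
    exact this.congr_deriv (by simp)
  have hpow (j : ℕ) : HasDerivAt (fun t : ℝ => ((1 - t)⁻¹) ^ j)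
      (j * ((1 - t)⁻¹) ^ (j + 1)) t := by
    rcases j with - | j
    · simpa using hasDerivAt_const t (1 : ℝ)
    · refine (hinv.pow (j + 1)).congr_deriv ?_
      rw [Nat.add_sub_cancel]
      ring
  have hexp : HasDerivAt (fun t : ℝ => Real.exp (δ * (t / (1 - t))))
      (Real.exp (δ * (t / (1 - t))) * (δ * ((1 - t)⁻¹) ^ 2)) t := by
    have h : HasDerivAt (fun t : ℝ => δ * (t / (1 - t))) (δ * ((1 - t)⁻¹) ^ 2) t := by
      have := ((hasDerivAt_id t).div ((hasDerivAt_id t).const_sub 1) hs).const_mul δ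
      refine this.congr_deriv ?_
      rw [id]
      field_simp
      ring
    exact h.exp
  have hsum : HasDerivAt (fun t : ℝ => ∑ k ∈ Finset.range (n + 1),
        momentCoeff m n k * δ ^ k * ((1 - t)⁻¹) ^ (m + 1 + n + k))
      (∑ k ∈ Finset.range (n + 1), momentCoeff m n k * δ ^ k *
        (((m + 1 + n + k : ℕ) : ℝ) * ((1 - t)⁻¹) ^ (m + 1 + n + k + 1))) t :=
    HasDerivAt.fun_sum fun k _ => (hpow _).const_mul _
  refine (hsum.mul hexp).congr_deriv ?_
  rw [chiSqMGFDeriv, mul_comm (∑ k ∈ Finset.range (n + 1 + 1), _), mul_left_comm,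
    mul_comm (∑ k ∈ Finset.range (n + 1), _) (Real.exp _), ← mul_add]
  congr 1
  set w := (1 - t)⁻¹
  -- the recursion of the coefficients, with the top term of the first sum equal to zero
  have h1 : ∑ k ∈ Finset.range (n + 1), momentCoeff m n k * δ ^ k *
        (((m + 1 + n + k : ℕ) : ℝ) * w ^ (m + 1 + n + k + 1))
      = ∑ k ∈ Finset.range (n + 2), momentCoeff m n k * δ ^ k *
        (((m + 1 + n + k : ℕ) : ℝ) * w ^ (m + 1 + n + k + 1)) := by
    rw [Finset.sum_range_succ _ (n + 1)]
    simp [momentCoeff]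
  rw [h1, Finset.sum_range_succ', Finset.sum_range_succ' _ (n + 1), momentCoeff_succ_zero,
    Finset.sum_mul, add_right_comm, ← Finset.sum_add_distrib]
  congr 1
  · refine Finset.sum_congr rfl fun k _ => ?_
    rw [momentCoeff_succ_succ]
    push_cast
    ring
  · push_cast
    ring

section noncentral

variable {m : ℕ} (μ : Fin (m + 1) → ℂ)

lemma Iio_subset_integrableExpSet :
    Set.Iio 1 ⊆ interior (integrableExpSet (fun y => quadForm 1 (μ + y)) (complexNormal 0 1)) := by
  refine interior_maximal (fun t ht => ?_) isOpen_Iio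
  have hq := (continuous_quadForm (1 : Matrix (Fin (m + 1)) (Fin (m + 1)) ℂ))
  refine ⟨by fun_prop, ?_⟩
  rw [hasFiniteIntegral_iff_ofReal (ae_of_all _ fun x => (Real.exp_pos _).le),
    lintegral_exp_mul_quadForm_one_add μ ht]
  exact ENNReal.ofReal_lt_top

lemma iteratedDeriv_mgf_quadForm (n : ℕ) {t : ℝ} (ht : t < 1) :
    iteratedDeriv n (mgf (fun y => quadForm 1 (μ + y)) (complexNormal 0 1)) t
      = chiSqMGFDeriv m (quadForm 1 μ) n t := by
  have hq := (continuous_quadForm (1 : Matrix (Fin (m + 1)) (Fin (m + 1)) ℂ))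
  induction n generalizing t with
  | zero =>
    have hs : 0 < 1 - t := by linarith
    rw [iteratedDeriv_zero, mgf, integral_eq_lintegral_of_nonneg_ae
      (ae_of_all _ fun x => (Real.exp_pos _).le) (by fun_prop),
      lintegral_exp_mul_quadForm_one_add μ ht, ENNReal.toReal_ofReal (by positivity)]
    have : (m ! : ℝ) ≠ 0 := by positivity
    simp [chiSqMGFDeriv, momentCoeff, this]
  | succ n ih =>
    rw [iteratedDeriv_succ]
    refine ((hasDerivAt_chiSqMGFDeriv m _ n ht).congr_of_eventuallyEq ?_).deriv
    filter_upwards [Iio_mem_nhds ht] with s hs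
    exact ih hs

/-- The exponentially weighted moments of the noncentral complex chi-square law. -/
lemma lintegral_quadForm_pow_mul_exp (n : ℕ) {t : ℝ} (ht : t < 1) :
    ∫⁻ y, ENNReal.ofReal (quadForm 1 (μ + y) ^ n * Real.exp (t * quadForm 1 (μ + y)))
        ∂complexNormal 0 1
      = ENNReal.ofReal (chiSqMGFDeriv m (quadForm 1 μ) n t) := by
  have hmem := Iio_subset_integrableExpSet μ ht
  rw [← iteratedDeriv_mgf_quadForm μ n ht, iteratedDeriv_mgf hmem,
    ofReal_integral_eq_lintegral_ofReal
      (integrable_pow_mul_exp_of_mem_interior_integrableExpSet hmem n)]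
  refine ae_of_all _ fun y => mul_nonneg (pow_nonneg ?_ n) (Real.exp_pos _).le
  rw [quadForm_one]
  positivity

end noncentral

/-- The law of `g / (g + h)` for a gamma variable `g` of integer shape and a fixed `h`. -/
lemma lintegral_gammaMeasure_ratio (e : ℕ) {h : ℝ} (hh : 0 < h) (f : ℝ → ℝ≥0∞) (hf : Measurable f) :
    ∫⁻ g, f (1 / (1 + h / g)) ∂gammaMeasure (e + 1 : ℕ) 1
      = ∫⁻ x in Set.Ioo 0 1, f x * (ENNReal.ofReal (x ^ e * ((1 - x)⁻¹) ^ (e + 2) / e !) *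
          ENNReal.ofReal (h ^ (e + 1) * Real.exp (-(x / (1 - x)) * h))) := by
  have hm : Measurable (gammaPDF (e + 1 : ℕ) 1) := by
    unfold gammaPDF
    fun_prop
  have himage : (fun x : ℝ => x / (1 - x) * h) '' Set.Ioo 0 1 = Set.Ioi 0 := by
    ext g
    constructor
    · rintro ⟨x, ⟨h0, h1⟩, rfl⟩
      have : 0 < 1 - x := by linarith
      exact Set.mem_Ioi.mpr (by positivity)
    · intro hg
      have hg' : 0 < g := hg
      refine ⟨g / (g + h), ⟨by positivity, (div_lt_one (by positivity)).mpr (by linarith)⟩, ?_⟩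
      have : 1 - g / (g + h) = h / (g + h) := by
        field_simp
        ring
      simp only [this]
      field_simp
  have hderiv (x : ℝ) (hx : x ∈ Set.Ioo (0 : ℝ) 1) :
      HasDerivWithinAt (fun x : ℝ => x / (1 - x) * h) (((1 - x)⁻¹) ^ 2 * h) (Set.Ioo 0 1) x := by
    have hs : 1 - x ≠ 0 := by linarith [hx.2]
    have := (((hasDerivAt_id x).div ((hasDerivAt_id x).const_sub 1) hs).mul_const h)
    refine (this.congr_deriv ?_).hasDerivWithinAt
    simp only [id]
    field_simp
    ring
  have hinj : Set.InjOn (fun x : ℝ => x / (1 - x) * h) (Set.Ioo 0 1) := by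
    intro x hx y hy hxy
    have h1 : 1 - x ≠ 0 := by linarith [hx.2]
    have h2 : 1 - y ≠ 0 := by linarith [hy.2]
    have := mul_right_cancel₀ hh.ne' hxy
    rw [div_eq_div_iff h1 h2] at this
    linarith
  calc _ = ∫⁻ g in Set.Ioi 0, gammaPDF (e + 1 : ℕ) 1 g * f (1 / (1 + h / g)) := by
        rw [gammaMeasure, lintegral_withDensity_eq_lintegral_mul _ hm (by fun_prop),
          ← lintegral_indicator measurableSet_Ioi]
        refine lintegral_congr_ae ?_
        filter_upwards [Measure.ae_ne volume (0 : ℝ)] with g hg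
        rcases lt_or_gt_of_ne hg with hg | hg
        · rw [Set.indicator_of_notMem (by simpa using hg.le), Pi.mul_apply,
            gammaPDF_of_neg hg, zero_mul]
        · rw [Set.indicator_of_mem (by simpa using hg), Pi.mul_apply]
    _ = _ := by
        rw [← himage, lintegral_image_eq_lintegral_abs_deriv_mul measurableSet_Ioo hderiv hinj]
        refine setLIntegral_congr_fun measurableSet_Ioo fun x hx => ?_
        have h0 := hx.1
        have hs : 0 < 1 - x := by linarith [hx.2]
        have hratio : 1 / (1 + h / (x / (1 - x) * h)) = x := by
          field_simp
          ring
        have hg : 0 ≤ x / (1 - x) * h := by positivity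
        simp only [hratio]
        rw [gammaPDF_of_nonneg hg, abs_of_nonneg (by positivity), ← mul_assoc,
          ← ENNReal.ofReal_mul (by positivity), ← ENNReal.ofReal_mul (by positivity), mul_comm]
        congr 2
        rw [Nat.cast_add_one, Real.Gamma_nat_eq_factorial, add_sub_cancel_right,
          Real.rpow_natCast, Real.one_rpow, mul_pow, div_pow, one_mul, neg_mul, inv_pow, inv_pow]
        field_simp
        ring

/-! ### The law of the detection statistic in whitened coordinates -/

/-- The conditional density of the ratio, averaged over the noncentral chi-square law, is the density
of the statistic with shape parameters `e + 1` and `m + 1`. -/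
lemma ratioDensity_eq (m e : ℕ) (δ : ℝ) {x : ℝ} (hx : x ∈ Set.Ioo (0 : ℝ) 1) :
    x ^ e * ((1 - x)⁻¹) ^ (e + 2) / e ! * chiSqMGFDeriv m δ (e + 1) (-(x / (1 - x)))
      = complexBetaPDF (e + 1) (m + 1) x * Real.exp (-(δ * x))
        * ∑ k ∈ Finset.range (e + 2), ((e + 1).choose k : ℝ) * ((m ! : ℝ) / ((m + 1 + k - 1)! : ℝ))
            * (δ * (1 - x)) ^ k := by
  have hs : 1 - x ≠ 0 := by linarith [hx.2]
  have h1 : (1 - -(x / (1 - x)))⁻¹ = 1 - x := by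
    field_simp
    ring
  have h2 : -(x / (1 - x)) / (1 - -(x / (1 - x))) = -x := by
    rw [div_eq_mul_inv, h1]
    field_simp
  rw [chiSqMGFDeriv, h1, h2, mul_neg, mul_comm (∑ k ∈ _, _) (Real.exp _), ← mul_assoc,
    mul_right_comm, mul_right_comm (complexBetaPDF _ _ _)]
  congr 1
  rw [Finset.mul_sum, Finset.mul_sum]
  refine Finset.sum_congr rfl fun k _ => ?_
  have h3 : m + 1 + k - 1 = m + k := by omega
  have h4 : e + 1 + (m + 1) - 1 = m + (e + 1) := by omega
  have h5 : m + 1 + (e + 1) + k = (e + 2) + m + k := by omega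
  simp only [momentCoeff, complexBetaPDF, h3, h4, h5, Nat.add_sub_cancel]
  have h6 : (m ! : ℝ) ≠ 0 := by positivity
  rw [pow_add, pow_add, mul_pow, inv_pow]
  field_simp
  ring

/-- The law of `1 / (1 + uᴴ S⁻¹ u)` for independent `u ~ CN(μ, 1)` and the scatter matrix `S` of `K`
standard complex normal vectors, tested against a measurable function. -/
lemma lintegral_one_div_one_add_quadForm {K m e : ℕ} (hK : K = m + 1 + e) (μ : Fin (m + 1) → ℂ)
    {f : ℝ → ℝ≥0∞} (hf : Measurable f) :
    ∫⁻ p, f (1 / (1 + quadForm (scatterMatrix p.2)⁻¹ (μ + p.1)))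
        ∂(complexNormal 0 1).prod (Measure.pi fun _ : Fin K => complexNormal 0 1)
      = ∫⁻ x in Set.Ioo 0 1, f x * ENNReal.ofReal (complexBetaPDF (e + 1) (m + 1) x
        * Real.exp (-(quadForm 1 μ * x))
        * ∑ k ∈ Finset.range (e + 2), ((e + 1).choose k : ℝ) * ((m ! : ℝ) / ((m + 1 + k - 1)! : ℝ))
            * (quadForm 1 μ * (1 - x)) ^ k) := by
  have hq := continuous_quadForm (1 : Matrix (Fin (m + 1)) (Fin (m + 1)) ℂ)
  have hS : Measurable fun p : (Fin (m + 1) → ℂ) × (Fin K → Fin (m + 1) → ℂ) =>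
      f (1 / (1 + quadForm (scatterMatrix p.2)⁻¹ (μ + p.1))) := by
    have := measurable_quadForm_inv
      (M := fun p : (Fin (m + 1) → ℂ) × (Fin K → Fin (m + 1) → ℂ) => scatterMatrix p.2)
      (v := fun p => μ + p.1)
      (fun i j => (measurable_scatterMatrix_apply i j).comp measurable_snd) (fun i => by fun_prop)
    exact hf.comp (by fun_prop)
  have hKm : K - m = e + 1 := by omega
  have hae : ∀ᵐ y ∂complexNormal (0 : Fin (m + 1) → ℂ) 1, μ + y ≠ 0 := by
    refine (withDensity_absolutelyContinuous _ _).ae_le ?_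
    filter_upwards [Measure.ae_ne volume (-μ)] with y hy h
    exact hy (eq_neg_of_add_eq_zero_right h)
  rw [lintegral_prod _ hS.aemeasurable]
  calc _ = ∫⁻ y, (∫⁻ x in Set.Ioo 0 1, f x * (ENNReal.ofReal
          (x ^ e * ((1 - x)⁻¹) ^ (e + 2) / e !) * ENNReal.ofReal (quadForm 1 (μ + y) ^ (e + 1) *
            Real.exp (-(x / (1 - x)) * quadForm 1 (μ + y))))) ∂complexNormal 0 1 := by
        refine lintegral_congr_ae ?_
        filter_upwards [hae] with y hy
        have hpos : 0 < quadForm 1 (μ + y) := by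
          rw [quadForm_one]
          obtain ⟨i, hi⟩ := Function.ne_iff.mp hy
          have hi' : 0 < ‖(μ + y) i‖ := norm_pos_iff.mpr hi
          exact Finset.sum_pos' (fun _ _ => by positivity) ⟨i, Finset.mem_univ i, by positivity⟩
        rw [lintegral_quadForm_scatterMatrix_inv (f := fun s => f (1 / (1 + s))) (by omega) hy
          (hf.comp (by fun_prop)), hKm, lintegral_gammaMeasure_ratio e hpos f hf]
    _ = ∫⁻ x in Set.Ioo 0 1, (∫⁻ y, f x * (ENNReal.ofReal
          (x ^ e * ((1 - x)⁻¹) ^ (e + 2) / e !) * ENNReal.ofReal (quadForm 1 (μ + y) ^ (e + 1) *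
            Real.exp (-(x / (1 - x)) * quadForm 1 (μ + y)))) ∂complexNormal 0 1) := by
        refine lintegral_lintegral_swap (Measurable.aemeasurable ?_)
        have := hq.measurable
        unfold Function.uncurry
        fun_prop
    _ = _ := by
        refine setLIntegral_congr_fun measurableSet_Ioo fun x hx => ?_
        have hx0 := hx.1
        have hs : 0 < 1 - x := by linarith [hx.2]
        have ht : -(x / (1 - x)) < 1 := by
          have : 0 < x / (1 - x) := by positivity
          linarith
        have hm : Measurable fun y : Fin (m + 1) → ℂ => ENNReal.ofReal
            (quadForm 1 (μ + y) ^ (e + 1) * Real.exp (-(x / (1 - x)) * quadForm 1 (μ + y))) := by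
          have := hq.measurable
          fun_prop
        rw [lintegral_const_mul _ (hm.const_mul _), lintegral_const_mul _ hm,
          lintegral_quadForm_pow_mul_exp μ (e + 1) ht, ← ENNReal.ofReal_mul (by positivity),
          ratioDensity_eq m e _ hx]

/-- A positive definite block matrix is whitened by a block upper triangular matrix, which acts on
the second block of coordinates alone. -/
lemma exists_block_whitening {ι κ : Type*} [Fintype ι] [DecidableEq ι] [Fintype κ] [DecidableEq κ]
    {M : Matrix (ι ⊕ κ) (ι ⊕ κ) ℂ} (hM : M.PosDef) :
    ∃ (C : Matrix (ι ⊕ κ) (ι ⊕ κ) ℂ) (D : Matrix κ κ ℂ), IsUnit C ∧ C * M * Cᴴ = 1 ∧ IsUnit D ∧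
      D * M.toBlocks₂₂ * Dᴴ = 1 ∧
      ∀ z : ι ⊕ κ → ℂ, (fun j => (C *ᵥ z) (Sum.inr j)) = D *ᵥ fun j => z (Sum.inr j) := by
  have h22 : M.toBlocks₂₂.PosDef := hM.submatrix (e := Sum.inr) Sum.inr_injective
  have hu : IsUnit M.toBlocks₂₂.det := (Matrix.isUnit_iff_isUnit_det _).mp h22.isUnit
  set X := M.toBlocks₁₂ * M.toBlocks₂₂⁻¹ with hX
  let T : Matrix (ι ⊕ κ) (ι ⊕ κ) ℂ := fromBlocks 1 (-X) 0 1
  have hT : IsUnit T := by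
    rw [Matrix.isUnit_iff_isUnit_det, det_fromBlocks_zero₂₁]
    simp
  have hX22 : X * M.toBlocks₂₂ = M.toBlocks₁₂ := by
    rw [hX, Matrix.mul_assoc, nonsing_inv_mul _ hu, Matrix.mul_one]
  have h21 : M.toBlocks₂₁ = M.toBlocks₁₂ᴴ := by
    ext i j
    exact (hM.isHermitian.apply (Sum.inr i) (Sum.inl j)).symm
  have h22X : M.toBlocks₂₂ * Xᴴ = M.toBlocks₂₁ := by
    rw [← h22.isHermitian.eq, ← conjTranspose_mul, hX22, h21]
  -- elimination of the off-diagonal blocks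
  have hTM : T * M * Tᴴ = fromBlocks (M.toBlocks₁₁ - X * M.toBlocks₂₁) 0 0 M.toBlocks₂₂ := by
    conv_lhs => rw [← fromBlocks_toBlocks M]
    simp only [T, fromBlocks_multiply, fromBlocks_conjTranspose, conjTranspose_one,
      conjTranspose_neg, conjTranspose_zero, Matrix.one_mul, Matrix.mul_one, Matrix.neg_mul,
      Matrix.mul_neg, Matrix.zero_mul, Matrix.mul_zero, zero_add, hX22, h22X]
    congr 1 <;> simp [sub_eq_add_neg]
  have hpos : (T * M * Tᴴ).PosDef := by
    refine hM.mul_mul_conjTranspose_same ?_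
    exact vecMul_injective_of_isUnit hT
  rw [hTM] at hpos
  have h11 : (M.toBlocks₁₁ - X * M.toBlocks₂₁).PosDef :=
    hpos.submatrix (e := Sum.inl) Sum.inl_injective
  obtain ⟨A, hA, hAM⟩ := exists_whitening h11
  obtain ⟨D, hD, hDM⟩ := exists_whitening h22
  refine ⟨fromBlocks A 0 0 D * T, D, ?_, ?_, hD, hDM, fun z => ?_⟩
  · refine IsUnit.mul ?_ hT
    rw [Matrix.isUnit_iff_isUnit_det] at hA hD ⊢
    rw [det_fromBlocks_zero₂₁]
    exact hA.mul hD
  · calc _ = fromBlocks A 0 0 D * (T * M * Tᴴ) * (fromBlocks A 0 0 D)ᴴ := by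
          rw [conjTranspose_mul]
          simp only [Matrix.mul_assoc]
      _ = 1 := by
          rw [hTM]
          simp only [fromBlocks_multiply, fromBlocks_conjTranspose, conjTranspose_zero,
            Matrix.zero_mul, Matrix.mul_zero, zero_add, add_zero, hAM, hDM, fromBlocks_one]
  · ext j
    simp only [T, fromBlocks_multiply, Matrix.mul_zero, Matrix.mul_one, Matrix.zero_mul, zero_add,
      add_zero, fromBlocks_mulVec, Sum.elim_inr, zero_mulVec]
    rfl

/-! ### From the data model to whitened coordinates -/

lemma quadForm_smul_one {ι : Type*} [Fintype ι] [DecidableEq ι] (c : ℂ) (v : ι → ℂ) :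
    quadForm 1 (c • v) = ‖c‖ ^ 2 * quadForm 1 v := by
  simp only [quadForm_one, Finset.mul_sum, Pi.smul_apply, smul_eq_mul, norm_mul, mul_pow]

/-- After whitening, the second blocks of the data are independent standard complex normal
vectors. -/
lemma map_whitened_data {ι κ Ω : Type*} [Fintype ι] [DecidableEq ι] [Fintype κ] [DecidableEq κ]
    {K : ℕ} [MeasurableSpace Ω] {P : Measure Ω} [IsProbabilityMeasure P]
    {M C : Matrix (ι ⊕ κ) (ι ⊕ κ) ℂ} {D : Matrix κ κ ℂ} (hM : M.PosDef)
    (hC : IsUnit C) (hCM : C * M * Cᴴ = 1)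
    (hCD : ∀ z : ι ⊕ κ → ℂ, (fun j => (C *ᵥ z) (Sum.inr j)) = D *ᵥ fun j => z (Sum.inr j))
    {n : Fin (K + 1) → Ω → ι ⊕ κ → ℂ} (hlaw : ∀ k, HasLaw (n k) (complexNormal 0 M) P)
    (hindep : iIndepFun n P) :
    P.map (fun ω => (D *ᵥ (fun j => n 0 ω (Sum.inr j)),
        fun k : Fin K => D *ᵥ fun j => n k.succ ω (Sum.inr j)))
      = (complexNormal 0 1).prod (Measure.pi fun _ => complexNormal 0 1) := by
  have h1 : P.map (fun ω k => n k ω) = Measure.pi fun _ : Fin (K + 1) => complexNormal 0 M := by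
    rw [(iIndepFun_iff_map_fun_eq_pi_map fun k => (hlaw k).aemeasurable).mp hindep]
    congr 1
    ext1 k
    exact (hlaw k).map_eq
  have h2 := pi_complexNormal_map_mulVec (K := K + 1) hC hM hCM
  have h3 : (Measure.pi fun _ : Fin (K + 1) => complexNormal (0 : ι ⊕ κ → ℂ) 1).map
      (fun w k j => w k (Sum.inr j)) = Measure.pi fun _ : Fin (K + 1) => complexNormal 0 1 := by
    have hp : IsProbabilityMeasure ((complexNormal (0 : ι ⊕ κ → ℂ) 1).map
        fun w j => w (Sum.inr j)) := complexNormal_map_inr (ι := ι) (κ := κ) ▸ inferInstance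
    rw [Measure.pi_map_pi (f := fun _ : Fin (K + 1) => fun (w : ι ⊕ κ → ℂ) j => w (Sum.inr j))
      fun _ => (by fun_prop : Measurable fun (w : ι ⊕ κ → ℂ) j => w (Sum.inr j)).aemeasurable,
      complexNormal_map_inr]
  rw [← (measurePreserving_tailRows K).map_eq, ← h3, ← h2, ← h1,
    Measure.map_map (by fun_prop) (by fun_prop), Measure.map_map (by fun_prop) (by fun_prop),
    AEMeasurable.map_map_of_aemeasurable (by fun_prop)
      (aemeasurable_pi_lambda _ fun k => (hlaw k).aemeasurable)]
  congr 1
  funext ω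
  simp only [Function.comp_apply, hCD]

lemma toBlocks₂₂_scatterMatrix {ι κ : Type*} {K : ℕ} (zs : Fin K → ι ⊕ κ → ℂ) :
    (scatterMatrix zs).toBlocks₂₂ = scatterMatrix fun k j => zs k (Sum.inr j) := rfl

lemma primaryData_inr {t r : ℕ} (i : Fin 2) (θ₁ : Fin t → ℂ) (θ₂ : Fin r → ℂ)
    (n : Fin t ⊕ Fin r → ℂ) :
    (fun j => primaryData i θ₁ θ₂ n (Sum.inr j))
      = ((i : ℕ) : ℂ) • θ₂ + fun j => n (Sum.inr j) := by
  ext j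
  simp [primaryData, Et, Er, fromRows_mulVec]

lemma ae_posDef_scatterMatrix {K r : ℕ} (hK : r ≤ K) :
    ∀ᵐ zs ∂Measure.pi fun _ : Fin K => complexNormal (0 : Fin r → ℂ) 1,
      (scatterMatrix zs).PosDef := by
  have hsw : MeasurePreserving (fun (z : Fin K → Fin r → ℂ) i k => z k i)
      (Measure.pi fun _ : Fin K => complexNormal (0 : Fin r → ℂ) 1)
      (Measure.pi fun _ : Fin r => complexNormal (0 : Fin K → ℂ) 1) :=
    ⟨by fun_prop, pi_complexNormal_map_swap⟩
  filter_upwards [hsw.quasiMeasurePreserving.ae (ae_posDef_mul_conjTranspose (m := r)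
    (ι := Fin K) (by simpa using hK))] with zs h
  exact h

end SubspaceDetection

theorem mainTheorem3
    {t r K : ℕ} (ht : 1 ≤ t) (hr : 1 ≤ r) (hK : t + r ≤ K)
    (M : Matrix (Fin t ⊕ Fin r) (Fin t ⊕ Fin r) ℂ) (hM : M.PosDef)
    (θ₁ : Fin 2 → Fin t → ℂ) (θ₂ : Fin r → ℂ) (i : Fin 2)
    {Ω : Type*} [MeasurableSpace Ω] (P : Measure Ω) [IsProbabilityMeasure P]
    (n : Fin (K + 1) → Ω → (Fin t ⊕ Fin r → ℂ))
    (hlaw : ∀ k, HasLaw (n k) (complexNormal 0 M) P)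
    (hindep : iIndepFun n P)
    (z : Ω → (Fin t ⊕ Fin r → ℂ))
    (hz : ∀ ω, z ω = primaryData i (θ₁ i) θ₂ (n 0 ω))
    (S : Ω → Matrix (Fin t ⊕ Fin r) (Fin t ⊕ Fin r) ℂ)
    (hS : ∀ ω, S ω = scatterMatrix (fun k : Fin K => n k.succ ω)) :
    (∀ᵐ ω ∂P, ((S ω).toBlocks₂₂).PosDef) ∧
    HasLaw (fun ω => p₃ (z ω) (S ω))
      (volume.withDensity fun x : ℝ => ENNReal.ofReal
        ((Set.Ioc (0 : ℝ) 1).indicator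
          (fun x => complexBetaPDF (K - r + 1) r x
            * Real.exp (-(((i : ℕ) : ℝ) * SINR θ₂ M * x))
            * ∑ k ∈ Finset.range (K - r + 2),
                ((K - r + 1).choose k : ℝ) * (((r - 1)! : ℝ) / ((r + k - 1)! : ℝ))
                  * (((i : ℕ) : ℝ) * SINR θ₂ M * (1 - x)) ^ k) x))
      P := by
  obtain ⟨m, rfl⟩ : ∃ m, r = m + 1 := ⟨r - 1, by omega⟩
  obtain ⟨e, he⟩ : ∃ e, K = m + 1 + e := ⟨K - (m + 1), by omega⟩
  obtain ⟨C, D, hC, hCM, hD, hDM, hCD⟩ := exists_block_whitening hM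
  have hmap := map_whitened_data hM hC hCM hCD hlaw hindep
  set Ψ : Ω → (Fin (m + 1) → ℂ) × (Fin K → Fin (m + 1) → ℂ) := fun ω =>
    (D *ᵥ (fun j => n 0 ω (Sum.inr j)), fun k : Fin K => D *ᵥ fun j => n k.succ ω (Sum.inr j))
    with hΨ
  have hΨm : AEMeasurable Ψ P := by
    have hg : Measurable fun x : Fin (K + 1) → Fin t ⊕ Fin (m + 1) → ℂ =>
        (D *ᵥ (fun j => x 0 (Sum.inr j)), fun k : Fin K => D *ᵥ fun j => x k.succ (Sum.inr j)) := by
      fun_prop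
    exact hg.comp_aemeasurable (aemeasurable_pi_lambda _ fun k => (hlaw k).aemeasurable)
  have hscatter (ω : Ω) : scatterMatrix (Ψ ω).2 = D * (S ω).toBlocks₂₂ * Dᴴ := by
    rw [hS, toBlocks₂₂_scatterMatrix, ← scatterMatrix_mulVec]
  set μ : Fin (m + 1) → ℂ := ((i : ℕ) : ℂ) • (D *ᵥ θ₂) with hμ
  have hp₃ (ω : Ω) : p₃ (z ω) (S ω)
      = 1 / (1 + quadForm (scatterMatrix (Ψ ω).2)⁻¹ (μ + (Ψ ω).1)) := by
    rw [p₃, hscatter, hz, primaryData_inr, hμ, ← mulVec_smul, hΨ, ← mulVec_add,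
      quadForm_inv_congr hD]
  have hδ : quadForm 1 μ = ((i : ℕ) : ℝ) * SINR θ₂ M := by
    have h := quadForm_inv_congr hD M.toBlocks₂₂ θ₂
    rw [hDM, inv_one] at h
    -- the noncentrality carries the factor `i ^ 2`, which is `i` for `i = 0, 1`
    have hi : ‖((i : ℕ) : ℂ)‖ ^ 2 = ((i : ℕ) : ℝ) := by
      fin_cases i <;> simp
    rw [hμ, quadForm_smul_one, hi, h, SINR]
  have hG : Measurable fun p : (Fin (m + 1) → ℂ) × (Fin K → Fin (m + 1) → ℂ) =>
      1 / (1 + quadForm (scatterMatrix p.2)⁻¹ (μ + p.1)) := by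
    have := measurable_quadForm_inv
      (M := fun p : (Fin (m + 1) → ℂ) × (Fin K → Fin (m + 1) → ℂ) => scatterMatrix p.2)
      (v := fun p => μ + p.1)
      (fun i j => (measurable_scatterMatrix_apply i j).comp measurable_snd) (fun i => by fun_prop)
    fun_prop
  refine ⟨?_, ?_, ?_⟩
  · have h : ∀ᵐ p ∂P.map Ψ, (scatterMatrix p.2).PosDef := by
      rw [hmap]
      exact Measure.quasiMeasurePreserving_snd.ae (ae_posDef_scatterMatrix (by omega))
    filter_upwards [ae_of_ae_map hΨm h] with ω hω
    rw [hscatter] at hω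
    exact (IsUnit.posDef_star_right_conjugate_iff hD).mp hω
  · simp_rw [hp₃]
    exact hG.comp_aemeasurable hΨm
  · have hcomp : (fun ω => p₃ (z ω) (S ω))
        = (fun p => 1 / (1 + quadForm (scatterMatrix p.2)⁻¹ (μ + p.1))) ∘ Ψ := funext hp₃
    rw [hcomp, ← AEMeasurable.map_map_of_aemeasurable hG.aemeasurable hΨm, hmap]
    ext s hs
    have hf : Measurable (s.indicator (fun _ => (1 : ℝ≥0∞))) := measurable_const.indicator hs
    have h := lintegral_one_div_one_add_quadForm he μ hf
    have hL : (((complexNormal (0 : Fin (m + 1) → ℂ) 1).prod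
        (Measure.pi fun _ : Fin K => complexNormal 0 1)).map
          fun p => 1 / (1 + quadForm (scatterMatrix p.2)⁻¹ (μ + p.1))) s
        = ∫⁻ p, s.indicator (fun _ => (1 : ℝ≥0∞))
            (1 / (1 + quadForm (scatterMatrix p.2)⁻¹ (μ + p.1)))
          ∂(complexNormal 0 1).prod (Measure.pi fun _ : Fin K => complexNormal 0 1) := by
      rw [← lintegral_map hf hG, lintegral_indicator_const hs, one_mul]
    have hKr : K - (m + 1) = e := by omega
    rw [hL, h, withDensity_apply _ hs, ← lintegral_indicator hs,
      ← lintegral_indicator measurableSet_Ioo]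
    refine lintegral_congr_ae ?_
    -- the two sides differ at most at the endpoint `x = 1`
    filter_upwards [Measure.ae_ne volume (1 : ℝ)] with x hx1
    by_cases hx : x ∈ Set.Ioo (0 : ℝ) 1
    · by_cases hxs : x ∈ s
      · simp only [Set.indicator_of_mem hx, Set.indicator_of_mem hxs,
          Set.indicator_of_mem (Set.Ioo_subset_Ioc_self hx), hδ, hKr, Nat.add_sub_cancel, one_mul]
      · simp only [Set.indicator_of_mem hx, Set.indicator_of_notMem hxs, zero_mul]
    · have hx' : x ∉ Set.Ioc (0 : ℝ) 1 := fun h => hx ⟨h.1, lt_of_le_of_ne h.2 hx1⟩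
      rw [Set.indicator_of_notMem hx]
      by_cases hxs : x ∈ s
      · rw [Set.indicator_of_mem hxs, Set.indicator_of_notMem hx', ENNReal.ofReal_zero]
      · rw [Set.indicator_of_notMem hxs]
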